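/- Theorem (Conditional McCann Interpolants). Let $Y,U$ be separable real Hilbert spaces, let $Y\times U$ carry the product Hilbert structure with distance $d$, let $\mu$ be a Borel probability measure on $Y$ and $1\le p<\infty$. Let $\mathcal P_p^\mu(Y\times U)$ be the set of Borel probability measures on $Y\times U$ with finite $p$-th moment and $Y$-marginal $\mu$, with $$W_p^\mu(\eta,\nu)=\Big(\int_Y W_p^p(\eta^y,\nu^y)\,d\mu(y)\Big)^{1/p},$$ where $\eta^y,\nu^y$ are the conditional measures given $y$ and $W_p$ is the Wasserstein distance on $U$. Let $\Pi_Y(\eta,\nu)$ be the set of triangular couplings, i.e. couplings $\pi$ of $\eta$ and $\nu$ with $y_0=y_1$ for $\pi$-a.e. $(y_0,u_0,y_1,u_1)$. Let $\eta,\nu\in\mathcal P_p^\mu(Y\times U)$ and let $T^\star(y,u)=(y,T^\star_U(y,u))$ be a Borel injective triangular map with $T^\star_\#\eta=\nu$ which solves the conditional Monge problem, i.e. minimizes $\int d(z,T(z))^p\,d\eta(z)$ among Borel triangular maps $T(y,u)=(y,T_U(y,u))$ with $T_\#\eta=\nu$, and suppose that it induces an optimal triangular coupling, i.e. $(I,T^\star)_\#\eta$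 minimizes $\int d^p\,d\pi$ over $\pi\in\Pi_Y(\eta,\nu)$. For $t\in[0,1]$ put $T_t=(1-t)I+tT^\star$ and $\gamma_t=(T_t)_\#\eta$. Then: (a) $\gamma_t\in\mathcal P_p^\mu(Y\times U)$ for all $t\in[0,1]$; the curve $(\gamma_t)_{t\in[0,1]}$ is absolutely continuous with respect to $W_p^\mu$ and is a constant speed geodesic from $\eta$ to $\nu$: $\gamma_0=\eta$, $\gamma_1=\nu$ and $W_p^\mu(\gamma_s,\gamma_t)=(t-s)\,W_p^\mu(\eta,\nu)$ for $0\le s\le t\le 1$. (b) If $p>1$, there is a Borel triangular vector field $v_t(y,u)=(0,v^U_t(y,u))$ such that for $\eta$-a.e. $(y,u)$ $$v_t(T_t(y,u))=(0,\,T^\star_U(y,u)-u)\qquad\text{for all } t\in[0,1].$$ Moreover, for every $1\le p<\infty$, any Borel triangular vector field $v$ satisfying this identity for a.e. $t\in(0,1)$ and $\eta$-a.e. $(y,u)$ generates the curve $(\gamma_t)$: one has $\int_0^1\!\int\|v_t\|\,d\gamma_t\,dt<\infty$ and $(\gamma_t,v_t)$ solves the continuity equation $\partial_t\gamma_t+\operatorname{div}(v_t\gamma_t)=0$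 on $(0,1)$, i.e. $$\int_0^1\int_{Y\times U}\big(\partial_t\varphi(z,t)+\langle v_t(z),\nabla_z\varphi(z,t)\rangle\big)\,d\gamma_t(z)\,dt=0$$ for every $\varphi(z,t)=\psi(\langle z,e_1\rangle,\dots,\langle z,e_d\rangle,t)$ with $d\in\mathbb N$, $e_1,\dots,e_d$ orthonormal in $Y\times U$ and $\psi\in C_c^\infty(\mathbb R^d\times(0,1))$. -/

import Mathlib

open MeasureTheory Set
open scoped ENNReal

noncomputable section

namespace CondOT

/-- The Hilbert space product `Y × U`, with inner product the sum of the inner products. -/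
abbrev Joint (Y U : Type*) := WithLp 2 (Y × U)

section General

variable {X : Type*} [NormedAddCommGroup X] [MeasurableSpace X]

/-- The measure `γ` has finite `p`-th moment. -/
def HasFiniteMoment (p : ℝ) (γ : Measure X) : Prop :=
  ∫⁻ x, ‖x‖ₑ ^ p ∂γ < ⊤

/-- The couplings of `α` and `β`. -/
def couplings (α β : Measure X) : Set (Measure (X × X)) :=
  {π | π.fst = α ∧ π.snd = β}

/-- The `p`-transport cost `∫ d(x₀, x₁)^p dπ(x₀, x₁)` of a plan. -/
def planCost (p : ℝ) (π : Measure (X × X)) : ℝ≥0∞ :=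
  ∫⁻ w, edist w.1 w.2 ^ p ∂π

/-- The usual `p`-Wasserstein distance (with values in `[0, ∞]`). -/
def wasserstein (p : ℝ) (α β : Measure X) : ℝ≥0∞ :=
  (⨅ π ∈ couplings α β, planCost p π) ^ (1 / p)

end General

section Conditional

variable {Y U : Type*}
  [NormedAddCommGroup Y] [InnerProductSpace ℝ Y] [CompleteSpace Y] [SecondCountableTopology Y]
  [MeasurableSpace Y] [BorelSpace Y]
  [NormedAddCommGroup U] [InnerProductSpace ℝ U] [CompleteSpace U] [SecondCountableTopology U]
  [MeasurableSpace U] [BorelSpace U]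

/-- The conditional `p`-Wasserstein space: probability measures on `Y × U` with finite `p`-th
moment and `Y`-marginal `μ`. -/
def condSpace (p : ℝ) (μ : ProbabilityMeasure Y) : Set (ProbabilityMeasure (Joint Y U)) :=
  {γ | HasFiniteMoment p (γ : Measure (Joint Y U)) ∧
    (γ : Measure (Joint Y U)).map (fun z => z.fst) = μ}

/-- The conditional measures `γ^y` of `γ` given `y`: the disintegration of `γ` along its
`Y`-marginal. -/
def conditional (γ : ProbabilityMeasure (Joint Y U)) (y : Y) : Measure U :=
  ((γ : Measure (Joint Y U)).map (WithLp.ofLp : Joint Y U → Y × U)).condKernel y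

/-- The conditional `p`-Wasserstein distance `(∫ W_p(η^y, ν^y)^p dμ(y))^(1/p)`. -/
def condWasserstein (p : ℝ) (μ : ProbabilityMeasure Y) (η ν : ProbabilityMeasure (Joint Y U)) :
    ℝ≥0∞ :=
  (∫⁻ y, wasserstein p (conditional η y) (conditional ν y) ^ p ∂(μ : Measure Y)) ^ (1 / p)

/-- The triangular couplings of `η` and `ν`: those under which the two `Y`-components agree
almost surely. -/
def triangularCouplings (η ν : ProbabilityMeasure (Joint Y U)) :
    Set (Measure (Joint Y U × Joint Y U)) :=
  {π | π ∈ couplings (η : Measure (Joint Y U)) (ν : Measure (Joint Y U)) ∧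
    ∀ᵐ w ∂π, w.1.fst = w.2.fst}

/-- `π` solves the conditional Kantorovich problem for the cost `d^p`. -/
def IsOptimalTriangularCoupling (p : ℝ) (η ν : ProbabilityMeasure (Joint Y U))
    (π : Measure (Joint Y U × Joint Y U)) : Prop :=
  π ∈ triangularCouplings η ν ∧ ∀ π' ∈ triangularCouplings η ν, planCost p π ≤ planCost p π'

/-- The triangular map `(y, u) ↦ (y, T_U(y, u))`. -/
def triMap (TU : Y × U → U) (z : Joint Y U) : Joint Y U :=
  WithLp.toLp 2 (z.fst, TU (z.fst, z.snd))

/-- The set of `U`-components of triangular transport maps from `η` to `ν`. -/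
def transportMaps (η ν : ProbabilityMeasure (Joint Y U)) : Set (Y × U → U) :=
  {TU | Measurable TU ∧ (η : Measure (Joint Y U)).map (triMap TU) = ν}

/-- `(y, u) ↦ (y, T_U(y, u))` solves the conditional Monge problem for the cost `d^p`. -/
def IsCondMongeSolution (p : ℝ) (η ν : ProbabilityMeasure (Joint Y U)) (TU : Y × U → U) : Prop :=
  TU ∈ transportMaps η ν ∧ ∀ SU ∈ transportMaps η ν,
    ∫⁻ z, edist z (triMap TU z) ^ p ∂(η : Measure (Joint Y U)) ≤
      ∫⁻ z, edist z (triMap SU z) ^ p ∂(η : Measure (Joint Y U))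

/-- The interpolating maps `T_t = (1 - t) I + t T`. -/
def interp (TU : Y × U → U) (t : ℝ) (z : Joint Y U) : Joint Y U :=
  (1 - t) • z + t • triMap TU z

/-- The displacement `(y, u) ↦ (0, T_U(y, u) - u)`. -/
def displacement (TU : Y × U → U) (z : Joint Y U) : Joint Y U :=
  WithLp.toLp 2 (0, TU (z.fst, z.snd) - z.snd)

set_option linter.unusedSectionVars false in
theorem measurable_triMap {TU : Y × U → U} (hTU : Measurable TU) :
    Measurable (triMap TU : Joint Y U → Joint Y U) := by
  have h : Measurable (WithLp.ofLp : Joint Y U → Y × U) := WithLp.measurable_ofLp 2 (Y × U)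
  exact (WithLp.measurable_toLp 2 (Y × U)).comp (h.fst.prodMk (hTU.comp h))

theorem measurable_interp {TU : Y × U → U} (hTU : Measurable TU) (t : ℝ) :
    Measurable (interp TU t : Joint Y U → Joint Y U) :=
  (measurable_id.const_smul (1 - t)).add ((measurable_triMap hTU).const_smul t)

/-- The McCann curve `γ_t = (T_t)_# η`. -/
def mccann (η : ProbabilityMeasure (Joint Y U)) (TU : Y × U → U) (hTU : Measurable TU) (t : ℝ) :
    ProbabilityMeasure (Joint Y U) :=
  η.map (measurable_interp hTU t).aemeasurable

/-- The curve `γ`, restricted to `[a, b]`, is absolutely continuous in the conditional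
`p`-Wasserstein space. -/
def IsACCurve (p : ℝ) (μ : ProbabilityMeasure Y) (a b : ℝ)
    (γ : ℝ → ProbabilityMeasure (Joint Y U)) : Prop :=
  (∀ t ∈ Icc a b, γ t ∈ condSpace p μ) ∧
  ∃ m : ℝ → ℝ, IntegrableOn m (Icc a b) ∧ ∀ s t, a ≤ s → s ≤ t → t ≤ b →
    condWasserstein p μ (γ s) (γ t) ≤ ENNReal.ofReal (∫ r in s..t, m r)

/-- The curve `γ`, restricted to `[0, 1]`, is a constant speed geodesic from `η` to `ν` in the
conditional `p`-Wasserstein space. -/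
def IsConstantSpeedGeodesic (p : ℝ) (μ : ProbabilityMeasure Y)
    (η ν : ProbabilityMeasure (Joint Y U)) (γ : ℝ → ProbabilityMeasure (Joint Y U)) : Prop :=
  (∀ t ∈ Icc (0 : ℝ) 1, γ t ∈ condSpace p μ) ∧ γ 0 = η ∧ γ 1 = ν ∧
  ∀ s t, 0 ≤ s → s ≤ t → t ≤ 1 →
    condWasserstein p μ (γ s) (γ t) = ENNReal.ofReal (t - s) * condWasserstein p μ η ν

/-- A time-dependent Borel vector field on `Y × U` of the form `v_t(y, u) = (0, v_t^U(y, u))`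
with `v^U` Borel. -/
def IsTriangularField (v : ℝ → Joint Y U → Joint Y U) : Prop :=
  ∃ vU : ℝ → Joint Y U → U, Measurable (Function.uncurry vU) ∧
    ∀ t z, v t z = WithLp.toLp 2 (0, vU t z)

end Conditional

section ContinuityEquation

variable {X : Type*} [NormedAddCommGroup X] [InnerProductSpace ℝ X] [CompleteSpace X]
  [MeasurableSpace X] [BorelSpace X]

/-- Cylindrical test functions on `X × (a, b)`: `φ(z, t) = ψ((⟪e₁, z⟫, …, ⟪e_d, z⟫), t)` with
`e₁, …, e_d` orthonormal and `ψ` smooth with compact support in `ℝ^d × (a, b)`. -/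
def IsCylTestFunction (a b : ℝ) (φ : X → ℝ → ℝ) : Prop :=
  ∃ (d : ℕ) (e : Fin d → X) (ψ : (Fin d → ℝ) × ℝ → ℝ),
    Orthonormal ℝ e ∧ ContDiff ℝ (⊤ : ℕ∞) ψ ∧ HasCompactSupport ψ ∧ tsupport ψ ⊆ univ ×ˢ Ioo a b ∧
    ∀ z t, φ z t = ψ (fun i => inner ℝ (e i) z, t)

/-- `∂_t γ_t + div(v_t γ_t) = 0` on `(a, b)` in the distributional sense, for a Borel curve of
measures `γ` and a Borel vector field `v` with `∫ ∫ ‖v_t‖ dγ_t dt < ⊤`. -/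
structure SolvesContinuityEquation (a b : ℝ) (γ : ℝ → Measure X) (v : ℝ → X → X) : Prop where
  curve_aemeasurable : AEMeasurable γ (volume.restrict (Ioo a b))
  field_measurable : Measurable (Function.uncurry v)
  field_integrable : ∫⁻ t in Ioo a b, ∫⁻ z, ‖v t z‖ₑ ∂(γ t) < ⊤
  weak : ∀ φ : X → ℝ → ℝ, IsCylTestFunction a b φ →
    ∫ t in Ioo a b, ∫ z, (deriv (fun s => φ z s) t +
      inner ℝ (v t z) (gradient (fun x => φ x t) z)) ∂(γ t) = 0

end ContinuityEquation

end CondOT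

end

/-!
McCann interpolation for the conditional Wasserstein distance.

**Optimality on the fibres.** Everything rests on the fact that a triangular map `T` which induces
an optimal triangular coupling is optimal on almost every fibre: `W_p^p(η^y, ν^y)` equals `∫ d(u,
T_U(y, u))^p dη^y(u)` for almost every `y`. The usual proof selects optimal plans measurably in `y`.
Here no selection theorem is used. Given a partition of `U` into small cells, a plan with marginals
`α`, `β` is approximated by a finite combination of the restrictions of `α ⊗ β` to products of
cells, with rational coefficients (`exists_rational_fillPlan`); its marginals are bounded by `α` and
`β`, and the defect is filled by a product measure (`fillPlan`). There are countably many such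
densities, they do not depend on `α` and `β`, and the resulting couplings depend measurably on `(α,
β)`; for measures with finite moments the infimum of their costs is `W_p^p(α, β)`
(`exists_countable_fillPlan`). Hence, if `T` failed to be optimal on a set of fibres which is not
null, a single one of these countably many families would be cheaper than `T` on a set of fibres of
positive measure, and using it there would contradict optimality (`ae_cost_le_wasserstein`). In
particular `y ↦ W_p(η^y, ν^y)` agrees almost everywhere with a measurable function.

**Geodesics.** The conditional measures of `γ_t` are the images of those of `η` under the fibre maps
`u ↦ (1 - t) u + t T_U(y, u)` (`condKer_map_triangular`). On each fibre this is the classical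
displacement interpolation along an optimal map, which is a constant speed geodesic by the triangle
inequality (`wasserstein_interpolation`), and the claim follows by integration over `y`.

**The velocity field.** For `p > 1`, two points of the support of an optimal plan satisfy the
two-point cyclical monotonicity inequality (`edist_rpow_add_le_of_optimal`), and strict convexity of
`‖·‖ ^ p` forbids two segments joining such pairs to meet at an interior time (`eq_of_combo_eq`).
So `(t, z) ↦ (t, T_t z)` is injective on `[0, 1] × Z` for a Borel set `Z` of full measure, its
inverse is Borel by the Lusin–Souslin theorem, and composing with the displacement gives the field
(`exists_velocity_field`).

**The continuity equation.** Along a segment, `∂_t φ + ⟪v_t, ∇φ⟫` is the time derivative of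
`φ(T_t z, t)`, whose integral over `(0, 1)` vanishes; integrating against `η` and using Fubini's
theorem gives the weak formulation (`solvesContinuityEquation_lineMap`).
-/

noncomputable section

namespace CondOT

open ProbabilityTheory Filter Topology

/-! ### Couplings and the Wasserstein distance -/

section Couplings

variable {X : Type*} [MeasurableSpace X]
  {α β γ : Measure X} {π : Measure (X × X)} {p : ℝ}

theorem isProbabilityMeasure_of_mem_couplings [IsProbabilityMeasure α]
    (h : π ∈ couplings α β) : IsProbabilityMeasure π := by
  refine ⟨?_⟩
  rw [← Measure.fst_univ, h.1, measure_univ]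

theorem lintegral_fst_of_mem_couplings (h : π ∈ couplings α β) {f : X → ℝ≥0∞}
    (hf : Measurable f) : ∫⁻ w, f w.1 ∂π = ∫⁻ x, f x ∂α := by
  rw [← h.1, Measure.fst, lintegral_map hf measurable_fst]

theorem lintegral_snd_of_mem_couplings (h : π ∈ couplings α β) {f : X → ℝ≥0∞}
    (hf : Measurable f) : ∫⁻ w, f w.2 ∂π = ∫⁻ x, f x ∂β := by
  rw [← h.2, Measure.snd, lintegral_map hf measurable_snd]

theorem map_prodMk_mem_couplings {Ω : Type*} [MeasurableSpace Ω] {P : Measure Ω} {f g : Ω → X}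
    (hf : Measurable f) (hg : Measurable g) :
    P.map (fun ω => (f ω, g ω)) ∈ couplings (P.map f) (P.map g) :=
  ⟨Measure.fst_map_prodMk hg, Measure.snd_map_prodMk hf⟩

variable [NormedAddCommGroup X]

theorem wasserstein_le_planCost (hp : 0 ≤ p) (h : π ∈ couplings α β) :
    wasserstein p α β ≤ planCost p π ^ (1 / p) :=
  ENNReal.rpow_le_rpow (iInf₂_le π h) (by positivity)

theorem wasserstein_rpow (hp : 0 < p) :
    wasserstein p α β ^ p = ⨅ π ∈ couplings α β, planCost p π := by
  rw [wasserstein, ← ENNReal.rpow_mul, one_div_mul_cancel hp.ne', ENNReal.rpow_one]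

variable [BorelSpace X] [SecondCountableTopology X]

theorem measurable_edist_rpow (p : ℝ) : Measurable fun w : X × X => edist w.1 w.2 ^ p := by
  fun_prop

theorem planCost_map_prodMk {Ω : Type*} [MeasurableSpace Ω] {P : Measure Ω} {f g : Ω → X}
    (hf : Measurable f) (hg : Measurable g) :
    planCost p (P.map (fun ω => (f ω, g ω))) = ∫⁻ ω, edist (f ω) (g ω) ^ p ∂P := by
  rw [planCost, lintegral_map (measurable_edist_rpow p) (hf.prodMk hg)]

variable [CompleteSpace X]

/-- Two plans with a common middle marginal are glued by making the outer variables conditionally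
independent given the middle one. -/
theorem exists_glue [IsProbabilityMeasure α] [IsProbabilityMeasure β]
    {π₁ π₂ : Measure (X × X)} (h₁ : π₁ ∈ couplings α β) (h₂ : π₂ ∈ couplings β γ) :
    ∃ G : Measure (X × X × X), G.map (fun g => (g.1, g.2.1)) = π₁ ∧ G.map (fun g => g.2) = π₂ := by
  have := isProbabilityMeasure_of_mem_couplings h₁
  have := isProbabilityMeasure_of_mem_couplings h₂
  have : IsProbabilityMeasure (π₁.map Prod.swap) := Measure.isProbabilityMeasure_map (by fun_prop)
  set κ₁ := (π₁.map Prod.swap).condKernel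
  set κ₂ := π₂.condKernel
  have e₁ : β ⊗ₘ κ₁ = π₁.map Prod.swap := by
    conv_rhs => rw [← Measure.disintegrate (π₁.map Prod.swap) κ₁]
    rw [Measure.fst_map_swap, h₁.2]
  have e₂ : β ⊗ₘ κ₂ = π₂ := by
    conv_rhs => rw [← Measure.disintegrate π₂ κ₂]
    rw [h₂.1]
  refine ⟨(β ⊗ₘ (κ₁ ×ₖ κ₂)).map (fun g => (g.2.1, g.1, g.2.2)), ?_, ?_⟩
  · have e₃ : π₁ = (β ⊗ₘ κ₁).map Prod.swap := by
      rw [e₁, Measure.map_map (by fun_prop) (by fun_prop)]; simp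
    rw [e₃, Measure.map_map (by fun_prop) (by fun_prop)]
    refine Measure.ext_of_lintegral _ fun f hf => ?_
    rw [lintegral_map hf (by fun_prop), lintegral_map hf (by fun_prop),
      Measure.lintegral_compProd (by fun_prop), Measure.lintegral_compProd (by fun_prop)]
    refine lintegral_congr fun y => ?_
    rw [Kernel.prod_apply, lintegral_prod _ (by fun_prop)]
    simp
  · rw [← e₂, Measure.map_map (by fun_prop) (by fun_prop)]
    refine Measure.ext_of_lintegral _ fun f hf => ?_
    rw [lintegral_map hf (by fun_prop), Measure.lintegral_compProd (by fun_prop),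
      Measure.lintegral_compProd (by fun_prop)]
    refine lintegral_congr fun y => ?_
    rw [Kernel.prod_apply, lintegral_prod _ (by fun_prop)]
    simp

theorem wasserstein_triangle [IsProbabilityMeasure α] [IsProbabilityMeasure β] (hp : 1 ≤ p) :
    wasserstein p α γ ≤ wasserstein p α β + wasserstein p β γ := by
  have hp0 : 0 < p := by linarith
  have key : ∀ π₁ ∈ couplings α β, ∀ π₂ ∈ couplings β γ,
      wasserstein p α γ ≤ planCost p π₁ ^ (1 / p) + planCost p π₂ ^ (1 / p) := by
    intro π₁ h₁ π₂ h₂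
    obtain ⟨G, g₁, g₂⟩ := exists_glue h₁ h₂
    have e₁ : G.map (fun g => g.1) = α := by
      rw [← h₁.1, ← g₁, Measure.fst, Measure.map_map (by fun_prop) (by fun_prop)]; rfl
    have e₂ : G.map (fun g => g.2.2) = γ := by
      rw [← h₂.2, ← g₂, Measure.snd, Measure.map_map (by fun_prop) (by fun_prop)]; rfl
    have hG := map_prodMk_mem_couplings (P := G) (f := fun g => g.1) (g := fun g => g.2.2)
      (by fun_prop) (by fun_prop)
    rw [e₁, e₂] at hG
    refine (wasserstein_le_planCost hp0.le hG).trans ?_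
    rw [planCost_map_prodMk (by fun_prop) (by fun_prop), ← g₁, ← g₂,
      planCost_map_prodMk (by fun_prop) (by fun_prop),
      planCost, lintegral_map (measurable_edist_rpow p) (by fun_prop)]
    refine le_trans ?_ (ENNReal.lintegral_Lp_add_le (μ := G) (f := fun g => edist g.1 g.2.1)
      (g := fun g => edist g.2.1 g.2.2) (by fun_prop) (by fun_prop) hp)
    gcongr with g
    exact edist_triangle _ _ _
  have hroot : ∀ (α β : Measure X),
      wasserstein p α β = ⨅ π : couplings α β, planCost p π.1 ^ (1 / p) := by
    intro α β
    rw [wasserstein, iInf_subtype']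
    exact (ENNReal.orderIsoRpow (1 / p) (by positivity)).map_iInf _
  rw [hroot α β, hroot β γ]
  exact ENNReal.le_iInf_add_iInf fun π₁ π₂ => key π₁ π₁.2 π₂ π₂.2

/-- The displacement interpolation along a map which induces an optimal plan is a geodesic for the
Wasserstein distance: the upper bound comes from the plan induced by the two interpolating maps,
the lower bound from the triangle inequality along `0 ≤ s ≤ t ≤ 1`. -/
theorem wasserstein_interpolation [NormedSpace ℝ X] [IsProbabilityMeasure α] {T : X → X}
    (hp : 1 ≤ p) (hT : Measurable T) (hfin : ∫⁻ x, edist x (T x) ^ p ∂α ≠ ⊤)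
    (hopt : ∫⁻ x, edist x (T x) ^ p ∂α ≤ wasserstein p α (α.map T) ^ p)
    {s t : ℝ} (hs : 0 ≤ s) (hst : s ≤ t) (ht : t ≤ 1) :
    wasserstein p (α.map fun x => (1 - s) • x + s • T x) (α.map fun x => (1 - t) • x + t • T x) =
      ENNReal.ofReal (t - s) * wasserstein p α (α.map T) := by
  have hp0 : 0 < p := by linarith
  set C : ℝ≥0∞ := (∫⁻ x, edist x (T x) ^ p ∂α) ^ (1 / p) with hC
  have hCfin : C ≠ ⊤ := by simp [hC, hp0.le, hfin]
  set S : ℝ → X → X := fun t x => (1 - t) • x + t • T x with hS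
  have hSm : ∀ t, Measurable (S t) := fun t => by fun_prop
  have hS0 : S 0 = id := by ext; simp [hS]
  have hS1 : S 1 = T := by ext; simp [hS]
  have upper : ∀ a b, a ≤ b → wasserstein p (α.map (S a)) (α.map (S b)) ≤
      ENNReal.ofReal (b - a) * C := by
    intro a b hab
    refine (wasserstein_le_planCost hp0.le (map_prodMk_mem_couplings (hSm a) (hSm b))).trans ?_
    rw [planCost_map_prodMk (hSm a) (hSm b)]
    have : ∀ x, edist (S a x) (S b x) ^ p = ENNReal.ofReal (b - a) ^ p * edist x (T x) ^ p := by
      intro x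
      rw [← ENNReal.mul_rpow_of_nonneg _ _ hp0.le, edist_dist, edist_dist, dist_eq_norm,
        dist_eq_norm, ← ENNReal.ofReal_mul (by linarith)]
      congr 2
      have : S a x - S b x = (b - a) • (x - T x) := by simp only [hS]; module
      rw [this, norm_smul, Real.norm_of_nonneg (by linarith)]
    simp_rw [this]
    rw [lintegral_const_mul _ (by fun_prop), ENNReal.mul_rpow_of_nonneg _ _ (by positivity),
      ← ENNReal.rpow_mul, mul_one_div_cancel hp0.ne', ENNReal.rpow_one]
  have lower : C ≤ wasserstein p α (α.map T) := by
    rw [hC, one_div]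
    exact (ENNReal.rpow_inv_le_iff hp0).2 hopt
  have h01 : wasserstein p α (α.map T) = C := by
    refine le_antisymm ?_ lower
    simpa [hS0, hS1] using upper 0 1 zero_le_one
  rw [h01]
  refine le_antisymm (upper s t hst) ?_
  have : IsProbabilityMeasure (α.map (S s)) := Measure.isProbabilityMeasure_map (by fun_prop)
  have : IsProbabilityMeasure (α.map (S t)) := Measure.isProbabilityMeasure_map (by fun_prop)
  have h1 : C ≤ ENNReal.ofReal s * C +
      (wasserstein p (α.map (S s)) (α.map (S t)) + ENNReal.ofReal (1 - t) * C) := by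
    rw [← h01]
    refine (wasserstein_triangle (β := α.map (S s)) hp).trans ?_
    refine add_le_add ?_ ((wasserstein_triangle (β := α.map (S t)) hp).trans ?_)
    · simpa [hS0, h01] using upper 0 s hs
    · refine add_le_add le_rfl ?_
      simpa [hS1, h01] using upper t 1 ht
  -- The lower bound follows by cancelling the finite outer terms.
  have h2 : C = ENNReal.ofReal s * C +
      (ENNReal.ofReal (t - s) * C + ENNReal.ofReal (1 - t) * C) := by
    rw [← add_mul, ← add_mul, ← ENNReal.ofReal_add (by linarith) (by linarith),
      ← ENNReal.ofReal_add (by linarith) (by linarith)]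
    simp
  nth_rewrite 1 [h2] at h1
  rw [ENNReal.add_le_add_iff_left (by finiteness),
    ENNReal.add_le_add_iff_right (by finiteness)] at h1
  exact h1

end Couplings

/-! ### Cyclical monotonicity of optimal plans -/

section Monotone

variable {X : Type*} [MeasurableSpace X] {α β γ δ : Measure X} {π ρ : Measure (X × X)} {p : ℝ}

theorem add_mem_couplings (h₁ : π ∈ couplings α β) (h₂ : ρ ∈ couplings γ δ) :
    π + ρ ∈ couplings (α + γ) (β + δ) :=
  ⟨by rw [Measure.fst_add, h₁.1, h₂.1], by rw [Measure.snd_add, h₁.2, h₂.2]⟩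

theorem smul_mem_couplings (c : ℝ≥0∞) (h : π ∈ couplings α β) :
    c • π ∈ couplings (c • α) (c • β) :=
  ⟨by rw [Measure.fst, Measure.map_smul, ← h.1]; rfl,
    by rw [Measure.snd, Measure.map_smul, ← h.2]; rfl⟩

variable [NormedAddCommGroup X]

theorem planCost_add : planCost p (π + ρ) = planCost p π + planCost p ρ :=
  lintegral_add_measure _ _ _

theorem planCost_smul (c : ℝ≥0∞) : planCost p (c • π) = c * planCost p π :=
  lintegral_smul_measure _ _

variable [BorelSpace X] [SecondCountableTopology X]

/-- If exchanging the targets of almost any two pairs drawn from `π` and `ρ` lowers the cost, then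
`π + ρ` can be replaced by a cheaper plan with the same marginals: sample the two pairs
independently and exchange their targets. -/
theorem exists_swap [IsProbabilityMeasure π] [IsProbabilityMeasure ρ]
    (hfin : planCost p π + planCost p ρ ≠ ⊤)
    (hlt : ∀ᵐ w₁ ∂π, ∀ᵐ w₂ ∂ρ, edist w₁.1 w₂.2 ^ p + edist w₂.1 w₁.2 ^ p <
      edist w₁.1 w₁.2 ^ p + edist w₂.1 w₂.2 ^ p) :
    ∃ σ ∈ couplings (π.fst + ρ.fst) (π.snd + ρ.snd),
      planCost p σ < planCost p π + planCost p ρ := by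
  set Q := π.prod ρ with hQ
  have q₁ : Q.map Prod.fst = π := by rw [hQ, Measure.map_fst_prod, measure_univ, one_smul]
  have q₂ : Q.map Prod.snd = ρ := by rw [hQ, Measure.map_snd_prod, measure_univ, one_smul]
  have hQ' : Q ≠ 0 := IsProbabilityMeasure.ne_zero Q
  refine ⟨Q.map (fun v => (v.1.1, v.2.2)) + Q.map (fun v => (v.2.1, v.1.2)), ?_, ?_⟩
  · have e₁ : Q.map (fun v => v.1.1) = π.fst := by
      rw [← q₁, Measure.fst, Measure.map_map (by fun_prop) (by fun_prop)]; rfl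
    have e₂ : Q.map (fun v => v.1.2) = π.snd := by
      rw [← q₁, Measure.snd, Measure.map_map (by fun_prop) (by fun_prop)]; rfl
    have e₃ : Q.map (fun v => v.2.1) = ρ.fst := by
      rw [← q₂, Measure.fst, Measure.map_map (by fun_prop) (by fun_prop)]; rfl
    have e₄ : Q.map (fun v => v.2.2) = ρ.snd := by
      rw [← q₂, Measure.snd, Measure.map_map (by fun_prop) (by fun_prop)]; rfl
    rw [← e₁, ← e₂, ← e₃, ← e₄, add_comm (Q.map fun v => v.1.2)]
    exact add_mem_couplings (map_prodMk_mem_couplings (by fun_prop) (by fun_prop))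
      (map_prodMk_mem_couplings (by fun_prop) (by fun_prop))
  · have c₁ : planCost p π = ∫⁻ v, edist v.1.1 v.1.2 ^ p ∂Q := by
      rw [planCost, ← q₁, lintegral_map (measurable_edist_rpow p) (by fun_prop)]
    have c₂ : planCost p ρ = ∫⁻ v, edist v.2.1 v.2.2 ^ p ∂Q := by
      rw [planCost, ← q₂, lintegral_map (measurable_edist_rpow p) (by fun_prop)]
    have hsum : planCost p π + planCost p ρ =
        ∫⁻ v, (edist v.1.1 v.1.2 ^ p + edist v.2.1 v.2.2 ^ p) ∂Q := by
      rw [c₁, c₂, lintegral_add_left (by fun_prop)]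
    have hae : ∀ᵐ v ∂Q, edist v.1.1 v.2.2 ^ p + edist v.2.1 v.1.2 ^ p <
        edist v.1.1 v.1.2 ^ p + edist v.2.1 v.2.2 ^ p := by
      rw [hQ, Measure.ae_prod_iff_ae_ae]
      · exact hlt
      · exact measurableSet_lt (by fun_prop) (by fun_prop)
    rw [planCost_add, planCost_map_prodMk (by fun_prop) (by fun_prop),
      planCost_map_prodMk (by fun_prop) (by fun_prop), ← lintegral_add_left (by fun_prop), hsum]
    rw [hsum] at hfin
    refine lintegral_strict_mono hQ' (by fun_prop) ?_ hae
    exact ne_top_of_le_ne_top hfin (lintegral_mono_ae (hae.mono fun v hv => hv.le))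

/-- Two points of the support of an optimal plan of finite cost satisfy the two-point
cyclical monotonicity inequality. -/
theorem edist_rpow_add_le_of_optimal [IsProbabilityMeasure α]
    (hπ : π ∈ couplings α β) (hopt : ∀ π' ∈ couplings α β, planCost p π ≤ planCost p π')
    (hfin : planCost p π ≠ ⊤) {w₁ w₂ : X × X}
    (h₁ : ∀ V, IsOpen V → w₁ ∈ V → π V ≠ 0) (h₂ : ∀ V, IsOpen V → w₂ ∈ V → π V ≠ 0) :
    edist w₁.1 w₁.2 ^ p + edist w₂.1 w₂.2 ^ p ≤ edist w₁.1 w₂.2 ^ p + edist w₂.1 w₁.2 ^ p := by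
  by_contra! hlt
  have := isProbabilityMeasure_of_mem_couplings hπ
  have hopen : IsOpen {v : (X × X) × X × X | edist v.1.1 v.2.2 ^ p + edist v.2.1 v.1.2 ^ p <
      edist v.1.1 v.1.2 ^ p + edist v.2.1 v.2.2 ^ p} := by
    have hc : Continuous fun x : ℝ≥0∞ => x ^ p := ENNReal.continuous_rpow_const
    refine isOpen_lt ?_ ?_ <;> fun_prop
  obtain ⟨V₁, V₂, o₁, o₂, m₁, m₂, hV⟩ := isOpen_prod_iff.1 hopen w₁ w₂ hlt
  replace h₁ := h₁ V₁ o₁ m₁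
  replace h₂ := h₂ V₂ o₂ m₂
  set π₁ := ProbabilityTheory.cond π V₁ with hπ₁
  set π₂ := ProbabilityTheory.cond π V₂ with hπ₂
  have : IsProbabilityMeasure π₁ := cond_isProbabilityMeasure h₁
  have : IsProbabilityMeasure π₂ := cond_isProbabilityMeasure h₂
  -- A multiple `c • (π₁ + π₂)` of the two localized plans is contained in `π`.
  set c := min (π V₁) (π V₂) / 2 with hc
  have hc0 : c ≠ 0 := by simp [hc, h₁, h₂]
  have hct : c ≠ ⊤ := by
    refine ENNReal.div_ne_top (ne_top_of_le_ne_top (measure_ne_top π V₁) (min_le_left _ _)) ?_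
    simp
  have hle : ∀ V, min (π V₁) (π V₂) ≤ π V → π V ≠ 0 → c • ProbabilityTheory.cond π V ≤
      (2⁻¹ : ℝ≥0∞) • π := by
    intro V hV hV0
    rw [ProbabilityTheory.cond, smul_smul]
    refine le_trans (b := (2⁻¹ : ℝ≥0∞) • π.restrict V) ?_ ?_
    · have : c * (π V)⁻¹ ≤ 2⁻¹ := by
        rw [hc, ENNReal.div_eq_inv_mul, mul_assoc, ← div_eq_mul_inv]
        exact mul_le_of_le_one_right' (ENNReal.div_le_of_le_mul (by simpa using hV))
      intro s
      simp only [Measure.smul_apply, smul_eq_mul]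
      gcongr
    · intro s
      simp only [Measure.smul_apply, smul_eq_mul]
      gcongr
      exact Measure.restrict_le_self
  have hsub : c • (π₁ + π₂) ≤ π := by
    rw [smul_add]
    refine (add_le_add (hle V₁ (min_le_left _ _) h₁) (hle V₂ (min_le_right _ _) h₂)).trans ?_
    rw [← add_smul, ENNReal.inv_two_add_inv_two, one_smul]
  have : IsFiniteMeasure (c • (π₁ + π₂)) := isFiniteMeasure_of_le π hsub
  have hdec := Measure.sub_add_cancel_of_le hsub
  set ρ := π - c • (π₁ + π₂) with hρ
  have hcost : planCost p π = planCost p ρ + c * (planCost p π₁ + planCost p π₂) := by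
    conv_lhs => rw [← hdec]
    rw [planCost_add, planCost_smul, planCost_add]
  have hρfin : planCost p ρ ≠ ⊤ := ne_top_of_le_ne_top hfin (by rw [hcost]; exact le_self_add)
  have h12 : planCost p π₁ + planCost p π₂ ≠ ⊤ := by
    intro h
    rw [hcost, h, ENNReal.mul_top hc0, add_top] at hfin
    exact hfin rfl
  obtain ⟨σ, hσ, hσlt⟩ := exists_swap h12 (by
    filter_upwards [ae_cond_mem o₁.measurableSet] with v₁ hv₁
    filter_upwards [ae_cond_mem o₂.measurableSet] with v₂ hv₂
    exact hV (Set.mk_mem_prod hv₁ hv₂))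
  have hmem : ρ + c • σ ∈ couplings α β := by
    rw [← hπ.1, ← hπ.2, ← hdec, Measure.fst_add, Measure.snd_add]
    refine add_mem_couplings ⟨rfl, rfl⟩ ?_
    have := smul_mem_couplings c (α := (π₁ + π₂).fst) (β := (π₁ + π₂).snd) ⟨rfl, rfl⟩
    rw [this.1, this.2]
    refine smul_mem_couplings c ?_
    rwa [Measure.fst_add, Measure.snd_add]
  have := hopt _ hmem
  rw [hcost, planCost_add, planCost_smul, ENNReal.add_le_add_iff_left hρfin,
    ENNReal.mul_le_mul_iff_right hc0 hct] at this
  exact absurd this (not_le.2 hσlt)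

end Monotone

/-! ### Completing a sub-plan to a coupling -/

section Fill

variable {X : Type*} [MeasurableSpace X] {α β : Measure X} {h : X × X → ℝ≥0∞} {p : ℝ}

/-- The density with respect to `α` of the first marginal of the measure with density `h` with
respect to `α ⊗ β`. The second marginal is obtained by applying this to `h ∘ Prod.swap`. -/
def marginalDensity (β : Measure X) (h : X × X → ℝ≥0∞) (x : X) : ℝ≥0∞ := ∫⁻ z, h (x, z) ∂β

/-- `h` is the density, with respect to `α ⊗ β`, of a measure whose marginals are bounded by `α`
and `β`. -/
def IsSubplanDensity (α β : Measure X) (h : X × X → ℝ≥0∞) : Prop :=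
  (∀ᵐ x ∂α, marginalDensity β h x ≤ 1) ∧ ∀ᵐ z ∂β, marginalDensity α (h ∘ Prod.swap) z ≤ 1

/-- The density with respect to `α ⊗ β` of the plan which completes the sub-plan of density `h` by
the normalized product of its two marginal defects. When the defects vanish the normalizing factor
is `0⁻¹ = ⊤`, which is multiplied by `0` almost everywhere. -/
def fillDensity (α β : Measure X) (h : X × X → ℝ≥0∞) (w : X × X) : ℝ≥0∞ :=
  h w + (1 - marginalDensity β h w.1) * (1 - marginalDensity α (h ∘ Prod.swap) w.2) *
    (∫⁻ x, (1 - marginalDensity β h x) ∂α)⁻¹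

/-- The completion of the sub-plan of density `h` to a coupling of `α` and `β`. -/
def fillPlan (α β : Measure X) (h : X × X → ℝ≥0∞) : Measure (X × X) :=
  (α.prod β).withDensity (fillDensity α β h)

@[fun_prop]
theorem measurable_marginalDensity [SFinite β] (hh : Measurable h) :
    Measurable (marginalDensity β h) :=
  hh.lintegral_prod_right'

theorem measurable_fillDensity [SFinite α] [SFinite β] (hh : Measurable h) :
    Measurable (fillDensity α β h) := by
  have : Measurable (h ∘ Prod.swap) := hh.comp measurable_swap
  unfold fillDensity
  fun_prop

theorem IsSubplanDensity.swap (hs : IsSubplanDensity α β h) :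
    IsSubplanDensity β α (h ∘ Prod.swap) :=
  ⟨hs.2, hs.1⟩

theorem lintegral_one_sub_marginalDensity_ne_top [IsFiniteMeasure α] :
    ∫⁻ x, (1 - marginalDensity β h x) ∂α ≠ ⊤ :=
  ne_top_of_le_ne_top (b := ∫⁻ _, 1 ∂α) (by simp)
    (lintegral_mono fun _ => tsub_le_self)

variable [IsProbabilityMeasure α] [IsProbabilityMeasure β]

theorem lintegral_one_sub_marginalDensity (hh : Measurable h)
    (hle : ∀ᵐ x ∂α, marginalDensity β h x ≤ 1) :
    ∫⁻ x, (1 - marginalDensity β h x) ∂α = 1 - ∫⁻ w, h w ∂(α.prod β) := by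
  have e : ∫⁻ w, h w ∂(α.prod β) = ∫⁻ x, marginalDensity β h x ∂α :=
    lintegral_prod _ (by fun_prop)
  rw [e, lintegral_sub (by fun_prop) _ hle]
  · simp
  · refine ne_top_of_le_ne_top (b := ∫⁻ _, 1 ∂α) (by simp) (lintegral_mono_ae hle)

theorem IsSubplanDensity.lintegral_defect_eq (hh : Measurable h) (hs : IsSubplanDensity α β h) :
    ∫⁻ z, (1 - marginalDensity α (h ∘ Prod.swap) z) ∂β = ∫⁻ x, (1 - marginalDensity β h x) ∂α := by
  rw [lintegral_one_sub_marginalDensity hh hs.1,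
    lintegral_one_sub_marginalDensity (hh.comp measurable_swap) hs.2]
  congr 1
  exact lintegral_prod_swap h

theorem IsSubplanDensity.lintegral_fillDensity (hh : Measurable h) (hs : IsSubplanDensity α β h) :
    ∀ᵐ x ∂α, ∫⁻ z, fillDensity α β h (x, z) ∂β = 1 := by
  have hh' : Measurable (h ∘ Prod.swap) := hh.comp measurable_swap
  set m := ∫⁻ x, (1 - marginalDensity β h x) ∂α with hm
  have hmt : m ≠ ⊤ := lintegral_one_sub_marginalDensity_ne_top
  have key : ∀ x, ∫⁻ z, fillDensity α β h (x, z) ∂β =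
      marginalDensity β h x + (1 - marginalDensity β h x) * (m * m⁻¹) := by
    intro x
    simp only [fillDensity, ← hm]
    rw [lintegral_add_left (by fun_prop), lintegral_mul_const _ (by fun_prop),
      lintegral_const_mul _ (by fun_prop), hs.lintegral_defect_eq hh, ← hm, mul_assoc]
    rfl
  by_cases hm0 : m = 0
  · have : ∀ᵐ x ∂α, 1 - marginalDensity β h x = 0 :=
      (lintegral_eq_zero_iff (by fun_prop)).1 hm0
    filter_upwards [this, hs.1] with x hx hx1
    rw [key, hx, zero_mul, add_zero]
    exact le_antisymm hx1 (tsub_eq_zero_iff_le.1 hx)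
  · filter_upwards [hs.1] with x hx1
    rw [key, ENNReal.mul_inv_cancel hm0 hmt, mul_one, add_tsub_cancel_of_le hx1]

theorem fillDensity_swap (hh : Measurable h) (hs : IsSubplanDensity α β h) (w : X × X) :
    fillDensity β α (h ∘ Prod.swap) w.swap = fillDensity α β h w := by
  simp only [fillDensity, Function.comp_apply, Prod.swap_swap, Prod.fst_swap, Prod.snd_swap]
  rw [hs.lintegral_defect_eq hh, mul_comm (1 - marginalDensity α (h ∘ Prod.swap) w.2)]
  rfl

theorem IsSubplanDensity.fillPlan_mem_couplings (hh : Measurable h)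
    (hs : IsSubplanDensity α β h) : fillPlan α β h ∈ couplings α β := by
  have hfst : ∀ {α β : Measure X} [IsProbabilityMeasure α] [IsProbabilityMeasure β]
      {h : X × X → ℝ≥0∞}, Measurable h → IsSubplanDensity α β h → (fillPlan α β h).fst = α := by
    intro α β _ _ h hh hs
    have hm := measurable_fillDensity (α := α) (β := β) hh
    refine Measure.ext_of_lintegral _ fun f hf => ?_
    rw [Measure.fst, lintegral_map hf (by fun_prop), fillPlan,
      lintegral_withDensity_eq_lintegral_mul _ hm (by fun_prop), lintegral_prod _ (by fun_prop)]
    refine lintegral_congr_ae ?_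
    filter_upwards [hs.lintegral_fillDensity hh] with x hx
    simp only [Pi.mul_apply]
    rw [lintegral_mul_const _ (by fun_prop), hx, one_mul]
  refine ⟨hfst hh hs, ?_⟩
  have hsw : fillPlan α β h = (fillPlan β α (h ∘ Prod.swap)).map Prod.swap := by
    have hm := measurable_fillDensity (α := α) (β := β) hh
    have hm' := measurable_fillDensity (α := β) (β := α) (hh.comp measurable_swap)
    refine Measure.ext_of_lintegral _ fun f hf => ?_
    rw [lintegral_map hf (by fun_prop), fillPlan, fillPlan,
      lintegral_withDensity_eq_lintegral_mul _ hm (by fun_prop),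
      lintegral_withDensity_eq_lintegral_mul _ hm' (by fun_prop), ← lintegral_prod_swap]
    refine lintegral_congr fun w => ?_
    simp only [Pi.mul_apply]
    rw [← fillDensity_swap hh hs w.swap, Prod.swap_swap]
  rw [hsw, Measure.snd_map_swap, hfst (hh.comp measurable_swap) hs.swap]

/-- The completion of a sub-plan costs at most the cost of the sub-plan plus the moments of the
marginal defects. -/
theorem IsSubplanDensity.planCost_fillPlan_le [NormedAddCommGroup X] [BorelSpace X]
    [SecondCountableTopology X] (hp : 1 ≤ p) (hh : Measurable h) (hs : IsSubplanDensity α β h) :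
    planCost p (fillPlan α β h) ≤ ∫⁻ w, edist w.1 w.2 ^ p * h w ∂(α.prod β) +
      2 ^ (p - 1) * (∫⁻ x, ‖x‖ₑ ^ p * (1 - marginalDensity β h x) ∂α +
        ∫⁻ z, ‖z‖ₑ ^ p * (1 - marginalDensity α (h ∘ Prod.swap) z) ∂β) := by
  have hh' : Measurable (h ∘ Prod.swap) := hh.comp measurable_swap
  set m := ∫⁻ x, (1 - marginalDensity β h x) ∂α with hm
  set a := fun x => 1 - marginalDensity β h x with ha
  set b := fun z => 1 - marginalDensity α (h ∘ Prod.swap) z with hb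
  have ham : Measurable a := by fun_prop
  have hbm : Measurable b := by fun_prop
  have hbint : ∫⁻ z, b z ∂β = m := hs.lintegral_defect_eq hh
  have hmm : m * m⁻¹ ≤ 1 := ENNReal.mul_inv_le_one m
  have hdist : ∀ w : X × X, edist w.1 w.2 ^ p ≤ 2 ^ (p - 1) * (‖w.1‖ₑ ^ p + ‖w.2‖ₑ ^ p) := by
    intro w
    refine le_trans ?_ (ENNReal.rpow_add_le_mul_rpow_add_rpow _ _ hp)
    gcongr
    rw [edist_eq_enorm_sub]
    exact enorm_sub_le
  have h1 : ∀ w : X × X, edist w.1 w.2 ^ p * fillDensity α β h w ≤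
      edist w.1 w.2 ^ p * h w + 2 ^ (p - 1) * m⁻¹ *
        (‖w.1‖ₑ ^ p * a w.1 * b w.2 + a w.1 * (‖w.2‖ₑ ^ p * b w.2)) := by
    intro w
    rw [fillDensity, mul_add]
    refine add_le_add le_rfl ?_
    refine (mul_le_mul_left (hdist w) _).trans (le_of_eq ?_)
    simp only [ha, hb]
    ring
  rw [planCost, fillPlan, lintegral_withDensity_eq_lintegral_mul _ (measurable_fillDensity hh)
    (measurable_edist_rpow p)]
  simp only [Pi.mul_apply]
  simp_rw [mul_comm (fillDensity α β h _)]
  refine (lintegral_mono h1).trans ?_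
  have hch : Measurable fun w : X × X => edist w.1 w.2 ^ p * h w := by fun_prop
  rw [lintegral_add_left hch, lintegral_const_mul _ (by fun_prop),
    lintegral_add_left (by fun_prop),
    lintegral_prod_mul (f := fun x : X => ‖x‖ₑ ^ p * a x) (g := b) (by fun_prop) (by fun_prop),
    lintegral_prod_mul (f := a) (g := fun z : X => ‖z‖ₑ ^ p * b z) (by fun_prop) (by fun_prop),
    hbint]
  have hfac : ∀ A B : ℝ≥0∞, 2 ^ (p - 1) * m⁻¹ * (A * m + m * B) ≤ 2 ^ (p - 1) * (A + B) := by
    intro A B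
    calc 2 ^ (p - 1) * m⁻¹ * (A * m + m * B) = 2 ^ (p - 1) * ((m * m⁻¹) * (A + B)) := by ring
      _ ≤ 2 ^ (p - 1) * (A + B) := by
        gcongr
        exact mul_le_of_le_one_left' hmm
  exact add_le_add le_rfl (hfac _ _)

end Fill

/-! ### A countable family of nearly optimal couplings -/

section Discrete

variable {X : Type*} [MeasurableSpace X] {α β : Measure X} {π : Measure (X × X)} {N : X → ℕ}
  {p : ℝ}

/-- For the partition of `X` into the level sets of `N`, the density with respect to `α ⊗ β` of the
plan which gives the same mass as `π` to each product of two cells and is proportional to `α ⊗ β`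
there. -/
def cellDensity (α β : Measure X) (π : Measure (X × X)) (N : X → ℕ) (c : ℕ × ℕ) : ℝ≥0∞ :=
  π ((fun w => (N w.1, N w.2)) ⁻¹' {c}) / (α (N ⁻¹' {c.1}) * β (N ⁻¹' {c.2}))

theorem measure_cell_le_fst (hN : Measurable N) (hπ : π ∈ couplings α β) (c : ℕ × ℕ) :
    π ((fun w => (N w.1, N w.2)) ⁻¹' {c}) ≤ α (N ⁻¹' {c.1}) := by
  rw [← hπ.1, Measure.fst_apply (hN (measurableSet_singleton _))]
  refine measure_mono fun w hw => ?_
  simp only [mem_preimage, mem_singleton_iff] at hw ⊢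
  rw [← hw]

theorem measure_cell_le_snd (hN : Measurable N) (hπ : π ∈ couplings α β) (c : ℕ × ℕ) :
    π ((fun w => (N w.1, N w.2)) ⁻¹' {c}) ≤ β (N ⁻¹' {c.2}) := by
  rw [← hπ.2, Measure.snd_apply (hN (measurableSet_singleton _))]
  refine measure_mono fun w hw => ?_
  simp only [mem_preimage, mem_singleton_iff] at hw ⊢
  rw [← hw]

theorem measure_cell_eq_zero (hN : Measurable N) (hπ : π ∈ couplings α β) {c : ℕ × ℕ}
    (h0 : α (N ⁻¹' {c.1}) * β (N ⁻¹' {c.2}) = 0) :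
    π ((fun w => (N w.1, N w.2)) ⁻¹' {c}) = 0 := by
  rcases mul_eq_zero.1 h0 with h | h
  · exact le_antisymm (h ▸ measure_cell_le_fst hN hπ c) zero_le
  · exact le_antisymm (h ▸ measure_cell_le_snd hN hπ c) zero_le

theorem cellDensity_ne_top [IsProbabilityMeasure α] (hN : Measurable N)
    (hπ : π ∈ couplings α β) (c : ℕ × ℕ) : cellDensity α β π N c ≠ ⊤ := by
  have := isProbabilityMeasure_of_mem_couplings hπ
  -- On null products of cells the density is `0 / 0 = 0`, because `π` vanishes there.
  by_cases h0 : α (N ⁻¹' {c.1}) * β (N ⁻¹' {c.2}) = 0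
  · simp [cellDensity, measure_cell_eq_zero hN hπ h0]
  · exact ENNReal.div_ne_top (measure_ne_top _ _) h0

variable [IsProbabilityMeasure α] [IsProbabilityMeasure β]

theorem cellDensity_mul (hN : Measurable N) (hπ : π ∈ couplings α β) (c : ℕ × ℕ) :
    cellDensity α β π N c * (α (N ⁻¹' {c.1}) * β (N ⁻¹' {c.2})) =
      π ((fun w => (N w.1, N w.2)) ⁻¹' {c}) := by
  by_cases h0 : α (N ⁻¹' {c.1}) * β (N ⁻¹' {c.2}) = 0
  · rw [h0, mul_zero, measure_cell_eq_zero hN hπ h0]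
  · exact ENNReal.div_mul_cancel h0 (by finiteness)

theorem lintegral_mul_cellDensity (hN : Measurable N) (hπ : π ∈ couplings α β)
    (g : ℕ × ℕ → ℝ≥0∞) :
    ∫⁻ w, g (N w.1, N w.2) * cellDensity α β π N (N w.1, N w.2) ∂(α.prod β) =
      ∫⁻ w, g (N w.1, N w.2) ∂π := by
  have hM : Measurable fun w : X × X => (N w.1, N w.2) := by fun_prop
  rw [← lintegral_map (f := fun c => g c * cellDensity α β π N c) (by fun_prop) hM,
    ← lintegral_map (f := g) (by fun_prop) hM, lintegral_countable', lintegral_countable']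
  refine tsum_congr fun c => ?_
  rw [Measure.map_apply hM (measurableSet_singleton _),
    Measure.map_apply hM (measurableSet_singleton _), mul_assoc]
  congr 1
  rw [← cellDensity_mul hN hπ c]
  congr 1
  rw [← Measure.prod_prod]
  congr 1
  ext w
  simp [Prod.ext_iff]

/-- Spreading a coupling over the cells does not change its first marginal. -/
theorem marginalDensity_cellDensity (hN : Measurable N) (hπ : π ∈ couplings α β) :
    ∀ᵐ x ∂α, marginalDensity β (fun w => cellDensity α β π N (N w.1, N w.2)) x = 1 := by
  have hnull : ∀ᵐ x ∂α, ∀ i, α (N ⁻¹' {i}) = 0 → N x ≠ i := by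
    rw [ae_all_iff]
    intro i
    by_cases hi : α (N ⁻¹' {i}) = 0
    · filter_upwards [measure_eq_zero_iff_ae_notMem.1 hi] with x hx _ using hx
    · exact ae_of_all _ fun x h => absurd h hi
  filter_upwards [hnull] with x hx
  have h0 : α (N ⁻¹' {N x}) ≠ 0 := fun h => hx _ h rfl
  simp only [marginalDensity]
  rw [← lintegral_map (f := fun j => cellDensity α β π N (N x, j)) (by fun_prop) hN,
    lintegral_countable']
  have hsum : α (N ⁻¹' {N x}) * ∑' j, cellDensity α β π N (N x, j) * (β.map N) {j} =
      α (N ⁻¹' {N x}) * 1 := by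
    rw [← ENNReal.tsum_mul_left, mul_one]
    have : ∀ j, α (N ⁻¹' {N x}) * (cellDensity α β π N (N x, j) * (β.map N) {j}) =
        π ((fun w => (N w.1, N w.2)) ⁻¹' {(N x, j)}) := by
      intro j
      rw [Measure.map_apply hN (measurableSet_singleton _), ← cellDensity_mul hN hπ]
      ring
    simp_rw [this]
    rw [← hπ.1, Measure.fst_apply (hN (measurableSet_singleton _)), ← measure_iUnion]
    · congr 1
      ext w
      simp [Prod.ext_iff]
    · intro i j hij
      refine Set.disjoint_left.2 fun w hw hw' => hij ?_
      simp only [mem_preimage, mem_singleton_iff, Prod.ext_iff] at hw hw'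
      exact hw.2.symm.trans hw'.2
    · intro j
      exact (show Measurable fun w : X × X => (N w.1, N w.2) by fun_prop)
        (measurableSet_singleton _)
  exact (ENNReal.mul_right_inj h0 (measure_ne_top _ _)).1 hsum

/-- If densities `h n` converge from below to the density of a plan with first marginal `α`, the
moments of the defect of their first marginals tend to zero. -/
theorem tendsto_lintegral_defect [NormedAddCommGroup X] [BorelSpace X] (hp : 0 ≤ p)
    {h : ℕ → X × X → ℝ≥0∞} {H : X × X → ℝ≥0∞} (hh : ∀ n, Measurable (h n))
    (hle : ∀ n w, h n w ≤ H w) (hlim : ∀ w, Tendsto (fun n => h n w) atTop (𝓝 (H w)))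
    (hmarg : ∀ᵐ x ∂α, marginalDensity β H x = 1) (hα : HasFiniteMoment p α) :
    Tendsto (fun n => ∫⁻ x, ‖x‖ₑ ^ p * (1 - marginalDensity β (h n) x) ∂α) atTop (𝓝 0) := by
  have : Tendsto (fun n => ∫⁻ x, ‖x‖ₑ ^ p * (1 - marginalDensity β (h n) x) ∂α) atTop
      (𝓝 (∫⁻ _, 0 ∂α)) := by
    refine tendsto_lintegral_of_dominated_convergence (fun x => ‖x‖ₑ ^ p)
      (fun n => by have := hh n; fun_prop) (fun n => ae_of_all _ fun x => ?_) hα.ne ?_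
    · exact mul_le_of_le_one_right' tsub_le_self
    · filter_upwards [hmarg] with x hx
      have h1 : Tendsto (fun n => marginalDensity β (h n) x) atTop (𝓝 (marginalDensity β H x)) := by
        refine tendsto_lintegral_of_dominated_convergence (fun z => H (x, z))
          (fun n => by have := hh n; fun_prop) (fun n => ae_of_all _ fun z => hle n _) ?_
          (ae_of_all _ fun z => hlim _)
        change marginalDensity β H x ≠ ⊤
        simp [hx]
      rw [hx] at h1
      have h2 := ENNReal.Tendsto.sub (tendsto_const_nhds (x := (1 : ℝ≥0∞)) (f := atTop (α := ℕ)))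
        h1 (Or.inl ENNReal.one_ne_top)
      have h3 := ENNReal.Tendsto.const_mul (a := ‖x‖ₑ ^ p) h2 (Or.inr (by finiteness))
      simpa using h3
  simpa using this

end Discrete

theorem exists_measurable_cellIndex {X : Type*} [NormedAddCommGroup X] [MeasurableSpace X]
    [BorelSpace X] [SecondCountableTopology X] {δ : ℝ≥0∞} (hδ : 0 < δ) :
    ∃ N : X → ℕ, Measurable N ∧ ∀ x, edist x (TopologicalSpace.denseSeq X (N x)) ≤ δ := by
  have hex : ∀ x : X, ∃ n, edist x (TopologicalSpace.denseSeq X n) < δ := by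
    intro x
    obtain ⟨n, hn⟩ := (TopologicalSpace.denseRange_denseSeq X).exists_mem_open
      (Metric.isOpen_eball (x := x) (ε := δ)) ⟨x, Metric.mem_eball_self hδ⟩
    exact ⟨n, by rw [edist_comm]; exact hn⟩
  classical
  refine ⟨fun x => Nat.find (hex x), measurable_find hex fun k => ?_,
    fun x => (Nat.find_spec (hex x)).le⟩
  exact measurableSet_lt (by fun_prop) measurable_const


theorem edist_rpow_le_add_rpow {X : Type*} [NormedAddCommGroup X] {p : ℝ} {x y x' y' : X}
    {δ : ℝ≥0∞} (hp : 0 ≤ p) (hx : edist x x' ≤ δ)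
    (hy : edist y y' ≤ δ) : edist x y ^ p ≤ (edist x' y' + 2 * δ) ^ p := by
  gcongr
  calc edist x y ≤ edist x x' + edist x' y' + edist y' y := edist_triangle4 _ _ _ _
    _ ≤ δ + edist x' y' + δ := by
      gcongr
      rwa [edist_comm]
    _ = edist x' y' + 2 * δ := by ring

theorem measurable_gridDensity {X : Type*} [MeasurableSpace X] {N : X → ℕ}
    (hN : Measurable N) (n : ℕ) (f : ℕ × ℕ →₀ ℕ) :
    Measurable fun w : X × X => (f (N w.1, N w.2) : ℝ≥0∞) / (n + 1) := by
  have : Measurable fun w : X × X => (N w.1, N w.2) := by fun_prop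
  exact (measurable_of_countable (fun c => (f c : ℝ≥0∞) / (n + 1))).comp this

section Family

variable {X : Type*} [NormedAddCommGroup X] [MeasurableSpace X] [BorelSpace X]
  [SecondCountableTopology X] {α β : Measure X} {π : Measure (X × X)} {N : X → ℕ} {p : ℝ}

/-- Spreading a plan over the products of cells of size `δ` increases the cost by little: it is
compared with the cost between the centres of the cells. -/
theorem lintegral_edist_rpow_mul_cellDensity_le [IsProbabilityMeasure α] [IsProbabilityMeasure β]
    (hp : 1 ≤ p) {δ : ℝ≥0∞} (hN : Measurable N)
    (hNδ : ∀ x, edist x (TopologicalSpace.denseSeq X (N x)) ≤ δ) (hπ : π ∈ couplings α β) :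
    ∫⁻ w, edist w.1 w.2 ^ p * cellDensity α β π N (N w.1, N w.2) ∂(α.prod β) ≤
      (planCost p π ^ (1 / p) + 4 * δ) ^ p := by
  have hp0 : 0 < p := by linarith
  have := isProbabilityMeasure_of_mem_couplings hπ
  set q := TopologicalSpace.denseSeq X
  calc ∫⁻ w, edist w.1 w.2 ^ p * cellDensity α β π N (N w.1, N w.2) ∂(α.prod β)
      ≤ ∫⁻ w, (fun c : ℕ × ℕ => (edist (q c.1) (q c.2) + 2 * δ) ^ p) (N w.1, N w.2) *
          cellDensity α β π N (N w.1, N w.2) ∂(α.prod β) := by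
        refine lintegral_mono fun w => mul_le_mul_left ?_ _
        exact edist_rpow_le_add_rpow hp0.le (hNδ _) (hNδ _)
    _ = ∫⁻ w, (edist (q (N w.1)) (q (N w.2)) + 2 * δ) ^ p ∂π :=
        lintegral_mul_cellDensity hN hπ fun c => (edist (q c.1) (q c.2) + 2 * δ) ^ p
    _ ≤ ∫⁻ w, (edist w.1 w.2 + 4 * δ) ^ p ∂π := by
        refine lintegral_mono fun w => ?_
        have h1 : edist (q (N w.1)) (q (N w.2)) ^ (1 : ℝ) ≤ (edist w.1 w.2 + 2 * δ) ^ (1 : ℝ) :=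
          edist_rpow_le_add_rpow zero_le_one (by rw [edist_comm]; exact hNδ _)
            (by rw [edist_comm]; exact hNδ _)
        rw [ENNReal.rpow_one, ENNReal.rpow_one] at h1
        refine ENNReal.rpow_le_rpow ?_ hp0.le
        calc _ ≤ edist w.1 w.2 + 2 * δ + 2 * δ := by gcongr
          _ = edist w.1 w.2 + 4 * δ := by ring
    _ = ((∫⁻ w, (edist w.1 w.2 + 4 * δ) ^ p ∂π) ^ (1 / p)) ^ p := by
        rw [← ENNReal.rpow_mul, one_div_mul_cancel hp0.ne', ENNReal.rpow_one]
    _ ≤ _ := by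
        refine ENNReal.rpow_le_rpow ((ENNReal.lintegral_Lp_add_le (μ := π)
          (f := fun w => edist w.1 w.2) (g := fun _ => 4 * δ) (by fun_prop) (by fun_prop)
          hp).trans ?_) hp0.le
        rw [lintegral_const, measure_univ, mul_one, ← ENNReal.rpow_mul, mul_one_div_cancel hp0.ne',
          ENNReal.rpow_one, planCost]

/-- A matrix with finite entries is approximated from below by matrices with finitely many non-zero
entries, all of them rational with denominator `n + 1`. -/
theorem exists_tendsto_rational (H : ℕ × ℕ → ℝ≥0∞) (hH : ∀ c, H c ≠ ⊤) :
    ∃ f : ℕ → ℕ × ℕ →₀ ℕ, (∀ n c, (f n c : ℝ≥0∞) / (n + 1) ≤ H c) ∧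
      ∀ c, Tendsto (fun n => (f n c : ℝ≥0∞) / (n + 1)) atTop (𝓝 (H c)) := by
  classical
  set F : ℕ → ℕ × ℕ →₀ ℕ := fun n => Finsupp.onFinset (Finset.range n ×ˢ Finset.range n)
    (fun c => if c ∈ Finset.range n ×ˢ Finset.range n then ⌊(H c).toReal * (n + 1)⌋₊ else 0)
    (fun c hc => by by_contra h; simp [h] at hc) with hF
  have cast : ∀ n c, (F n c : ℝ≥0∞) / (n + 1) = ENNReal.ofReal ((F n c : ℝ) / (n + 1)) := by
    intro n c
    rw [ENNReal.ofReal_div_of_pos (by positivity), ENNReal.ofReal_natCast,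
      ENNReal.ofReal_add (by positivity) zero_le_one, ENNReal.ofReal_natCast, ENNReal.ofReal_one]
  refine ⟨F, fun n c => ?_, fun c => ?_⟩
  · rw [cast, ← ENNReal.ofReal_toReal (hH c)]
    refine ENNReal.ofReal_le_ofReal ?_
    rw [div_le_iff₀ (by positivity)]
    simp only [hF, Finsupp.onFinset_apply]
    split_ifs
    · exact Nat.floor_le (by positivity)
    · rw [Nat.cast_zero]; positivity
  · simp_rw [cast]
    conv => rhs; rw [← ENNReal.ofReal_toReal (hH c)]
    refine ENNReal.tendsto_ofReal ?_
    have h1 := (tendsto_nat_floor_mul_div_atTop (R := ℝ) (a := (H c).toReal) (by positivity)).comp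
      (tendsto_atTop_add_const_right _ (1 : ℝ) tendsto_natCast_atTop_atTop)
    refine h1.congr' ?_
    filter_upwards [eventually_gt_atTop (max c.1 c.2)] with n hn
    have : c ∈ Finset.range n ×ˢ Finset.range n := by
      rw [Finset.mem_product, Finset.mem_range, Finset.mem_range]
      exact ⟨(le_max_left _ _).trans_lt hn, (le_max_right _ _).trans_lt hn⟩
    simp only [hF, Finsupp.onFinset_apply, if_pos this, Function.comp_apply]

/-- For a partition into cells of size `δ`, finitely many rational coefficients on the products of
cells give a sub-plan whose completion costs hardly more than a given plan. -/
theorem exists_rational_fillPlan [IsProbabilityMeasure α] [IsProbabilityMeasure β]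
    (hp : 1 ≤ p) {δ c : ℝ≥0∞} (hN : Measurable N)
    (hNδ : ∀ x, edist x (TopologicalSpace.denseSeq X (N x)) ≤ δ)
    (hα : HasFiniteMoment p α) (hβ : HasFiniteMoment p β) (hπ : π ∈ couplings α β)
    (hc : (planCost p π ^ (1 / p) + 4 * δ) ^ p < c) :
    ∃ (n : ℕ) (f : ℕ × ℕ →₀ ℕ),
      IsSubplanDensity α β (fun w => (f (N w.1, N w.2) : ℝ≥0∞) / (n + 1)) ∧
      planCost p (fillPlan α β fun w => (f (N w.1, N w.2) : ℝ≥0∞) / (n + 1)) < c := by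
  have hp0 : 0 < p := by linarith
  set H := cellDensity α β π N
  obtain ⟨f, hfle, hflim⟩ := exists_tendsto_rational H (cellDensity_ne_top hN hπ)
  set h : ℕ → X × X → ℝ≥0∞ := fun n w => (f n (N w.1, N w.2) : ℝ≥0∞) / (n + 1)
  have hm : ∀ n, Measurable (h n) := fun n => measurable_gridDensity hN n (f n)
  have hle : ∀ n w, h n w ≤ H (N w.1, N w.2) := fun n w => hfle n _
  have hlim : ∀ w, Tendsto (fun n => h n w) atTop (𝓝 (H (N w.1, N w.2))) := fun w => hflim _
  have hm₁ := marginalDensity_cellDensity hN hπ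
  have hπs : π.map Prod.swap ∈ couplings β α :=
    ⟨by rw [Measure.fst_map_swap, hπ.2], by rw [Measure.snd_map_swap, hπ.1]⟩
  have hm₂ : ∀ᵐ z ∂β,
      marginalDensity α ((fun w => H (N w.1, N w.2)) ∘ Prod.swap) z = 1 := by
    filter_upwards [marginalDensity_cellDensity hN hπs] with z hz
    rw [← hz]
    congr 1
    ext w
    have hm : Measurable fun w : X × X => (N w.1, N w.2) :=
      (hN.comp measurable_fst).prodMk (hN.comp measurable_snd)
    simp only [Function.comp_apply, Prod.fst_swap, Prod.snd_swap, cellDensity, H]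
    rw [Measure.map_apply measurable_swap (hm (measurableSet_singleton _)), mul_comm (β _)]
    congr 2
    ext v
    simp [Prod.ext_iff, and_comm]
  have hsub : ∀ n, IsSubplanDensity α β (h n) := by
    refine fun n => ⟨?_, ?_⟩
    · filter_upwards [hm₁] with x hx
      rw [← hx]
      exact lintegral_mono fun z => hle n _
    · filter_upwards [hm₂] with z hz
      rw [← hz]
      exact lintegral_mono fun x => hle n _
  have t₁ := tendsto_lintegral_defect hp0.le hm hle hlim hm₁ hα
  have t₂ := tendsto_lintegral_defect hp0.le (h := fun n => h n ∘ Prod.swap)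
    (fun n => (hm n).comp measurable_swap) (fun n w => hle n w.swap)
    (fun w => hlim w.swap) hm₂ hβ
  have t₃ := ENNReal.Tendsto.const_mul (a := 2 ^ (p - 1)) (t₁.add t₂)
    (Or.inr (ENNReal.rpow_ne_top_of_nonneg (by linarith) (by simp)))
  have t₄ := (tendsto_const_nhds
    (x := (planCost p π ^ (1 / p) + 4 * δ) ^ p)).add t₃
  rw [add_zero, mul_zero, add_zero] at t₄
  obtain ⟨n, hn⟩ := (t₄.eventually (gt_mem_nhds hc)).exists
  refine ⟨n, f n, hsub n, lt_of_le_of_lt ?_ hn⟩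
  refine ((hsub n).planCost_fillPlan_le hp (hm n)).trans (add_le_add ?_ le_rfl)
  refine le_trans (lintegral_mono fun w => ?_)
    (lintegral_edist_rpow_mul_cellDensity_le hp hN hNδ hπ)
  exact mul_le_mul_right (hle n w) _

/-- Countably many sub-plan densities suffice to approximate the optimal cost between any two
probability measures with finite moments. This replaces a measurable selection of optimal plans. -/
theorem exists_countable_fillPlan (X : Type*) [NormedAddCommGroup X] [MeasurableSpace X]
    [BorelSpace X] [SecondCountableTopology X] {p : ℝ} (hp : 1 ≤ p) :
    ∃ H : ℕ → X × X → ℝ≥0∞, (∀ n, Measurable (H n)) ∧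
      ∀ (α β : Measure X) [IsProbabilityMeasure α] [IsProbabilityMeasure β],
        HasFiniteMoment p α → HasFiniteMoment p β → ∀ π ∈ couplings α β, ∀ c, planCost p π < c →
          ∃ n, IsSubplanDensity α β (H n) ∧ planCost p (fillPlan α β (H n)) < c := by
  have hp0 : 0 < p := by linarith
  have hδ : ∀ k : ℕ, (0 : ℝ≥0∞) < ((k : ℝ≥0∞) + 1)⁻¹ := fun k => by simp
  choose N hN hNδ using fun k => exists_measurable_cellIndex (X := X) (hδ k)
  obtain ⟨e, he⟩ := exists_surjective_nat (ℕ × ℕ × (ℕ × ℕ →₀ ℕ))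
  refine ⟨fun n w => ((e n).2.2 (N (e n).1 w.1, N (e n).1 w.2) : ℝ≥0∞) / ((e n).2.1 + 1),
    fun n => measurable_gridDensity (hN _) _ _, ?_⟩
  intro α β _ _ hα hβ π hπ c hc
  -- The cells are chosen so small that spreading `π` over them keeps the cost below `c`.
  have hk : ∃ k : ℕ, (planCost p π ^ (1 / p) + 4 * ((k : ℝ≥0∞) + 1)⁻¹) ^ p < c := by
    have h0 : Tendsto (fun k : ℕ => ((k : ℝ≥0∞) + 1)⁻¹) atTop (𝓝 0) := by
      have := (tendsto_add_atTop_iff_nat 1).2 ENNReal.tendsto_inv_nat_nhds_zero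
      simpa using this
    have h1 := ENNReal.Tendsto.const_mul (a := 4) h0 (Or.inr (by simp))
    have h2 := ((tendsto_const_nhds (x := planCost p π ^ (1 / p))).add h1).ennrpow_const p
    rw [mul_zero, add_zero, ← ENNReal.rpow_mul, one_div_mul_cancel hp0.ne',
      ENNReal.rpow_one] at h2
    exact (h2.eventually (gt_mem_nhds hc)).exists
  obtain ⟨k, hk⟩ := hk
  obtain ⟨n, f, h₁, h₂⟩ := exists_rational_fillPlan hp (hN k) (hNδ k) hα hβ hπ hk
  obtain ⟨m, hm⟩ := he (k, n, f)
  exact ⟨m, by simpa only [hm] using h₁, by simpa only [hm] using h₂⟩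

end Family

/-! ### Optimality on the fibres -/

section Fibre

variable {Y U : Type*} [MeasurableSpace Y] [MeasurableSpace U] {κ l : Kernel Y U} {p : ℝ}

/-- The kernel `y ↦ S(y, ·)_# κ_y`. -/
def mapKernel {V : Type*} [MeasurableSpace V] (κ : Kernel Y U) (S : Y × U → V) : Kernel Y V :=
  (Kernel.id ×ₖ κ).map S

theorem mapKernel_apply {V : Type*} [MeasurableSpace V] [IsSFiniteKernel κ] {S : Y × U → V}
    (hS : Measurable S) (y : Y) : mapKernel κ S y = (κ y).map fun u => S (y, u) := by
  rw [mapKernel, Kernel.map_apply _ hS, Kernel.prod_apply, Kernel.id_apply, Measure.dirac_prod,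
    Measure.map_map hS (by fun_prop)]
  rfl

theorem isMarkovKernel_mapKernel {V : Type*} [MeasurableSpace V] [IsMarkovKernel κ]
    {S : Y × U → V} (hS : Measurable S) : IsMarkovKernel (mapKernel κ S) := by
  unfold mapKernel
  exact Kernel.IsMarkovKernel.map _ hS

theorem measurable_marginalDensity_kernel [IsSFiniteKernel l] {h : U × U → ℝ≥0∞}
    (hh : Measurable h) : Measurable fun v : Y × U => marginalDensity (l v.1) h v.2 := by
  have : Measurable fun q : (Y × U) × U => h (q.1.2, q.2) := by fun_prop
  exact this.lintegral_kernel_prod_right' (κ := l.comap Prod.fst measurable_fst)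

variable [IsMarkovKernel κ] [IsMarkovKernel l]

theorem measurable_fillDensity_kernel {h : U × U → ℝ≥0∞} (hh : Measurable h) :
    Measurable (Function.uncurry fun y : Y => fillDensity (κ y) (l y) h) := by
  have hh' : Measurable (h ∘ Prod.swap) := hh.comp measurable_swap
  have h₁ := measurable_marginalDensity_kernel (l := l) hh
  have h₂ := measurable_marginalDensity_kernel (l := κ) hh'
  have h₃ : Measurable fun y => ∫⁻ x, (1 - marginalDensity (l y) h x) ∂(κ y) :=
    (measurable_const.sub h₁).lintegral_kernel_prod_right'
  have e₁ : Measurable fun v : Y × U × U => marginalDensity (l v.1) h v.2.1 :=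
    h₁.comp (f := fun v : Y × U × U => (v.1, v.2.1)) (by fun_prop)
  have e₂ : Measurable fun v : Y × U × U => marginalDensity (κ v.1) (h ∘ Prod.swap) v.2.2 :=
    h₂.comp (f := fun v : Y × U × U => (v.1, v.2.2)) (by fun_prop)
  exact (hh.comp measurable_snd).add (((measurable_const.sub e₁).mul (measurable_const.sub e₂)).mul
    (h₃.comp measurable_fst).inv)

variable (κ l) in
/-- The kernel `y ↦ fillPlan κ_y l_y h`. -/
def fillKernel (h : U × U → ℝ≥0∞) : Kernel Y (U × U) :=
  (κ ×ₖ l).withDensity fun y => fillDensity (κ y) (l y) h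

theorem fillKernel_apply {h : U × U → ℝ≥0∞} (hh : Measurable h) (y : Y) :
    fillKernel κ l h y = fillPlan (κ y) (l y) h := by
  rw [fillKernel, Kernel.withDensity_apply _ (measurable_fillDensity_kernel hh),
    Kernel.prod_apply, fillPlan]

theorem measurableSet_ae_le_one {k : Y × U → ℝ≥0∞} (hk : Measurable k) :
    MeasurableSet {y | ∀ᵐ u ∂(κ y), k (y, u) ≤ 1} := by
  have : {y | ∀ᵐ u ∂(κ y), k (y, u) ≤ 1} = {y | ∫⁻ u, (k (y, u) - 1) ∂(κ y) = 0} := by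
    ext y
    simp only [mem_ofPred_eq]
    rw [lintegral_eq_zero_iff (by fun_prop)]
    simp [Filter.EventuallyEq, tsub_eq_zero_iff_le]
  rw [this]
  exact (hk.sub measurable_const).lintegral_kernel_prod_right' (measurableSet_singleton 0)

theorem measurableSet_isSubplanDensity {h : U × U → ℝ≥0∞} (hh : Measurable h) :
    MeasurableSet {y | IsSubplanDensity (κ y) (l y) h} :=
  (measurableSet_ae_le_one (measurable_marginalDensity_kernel hh)).inter
    (measurableSet_ae_le_one (measurable_marginalDensity_kernel (hh.comp measurable_swap)))

variable [NormedAddCommGroup U] [BorelSpace U] [SecondCountableTopology U]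

theorem measurable_planCost_kernel (σ : Kernel Y (U × U)) : Measurable fun y => planCost p (σ y) :=
  (measurable_edist_rpow p).lintegral_kernel

/-- If the plans induced by `T(y, ·)` are optimal among all measurable families of couplings of
`κ_y` and `l_y` in the averaged sense, then they are optimal for almost every `y`: otherwise one of
countably many explicit competitors would beat them on a set of positive measure. -/
theorem ae_cost_le_wasserstein {μ : Measure Y} (hp : 1 ≤ p) {T : Y × U → U} (hT : Measurable T)
    (hl : ∀ᵐ y ∂μ, l y = (κ y).map fun u => T (y, u))
    (hκm : ∀ᵐ y ∂μ, HasFiniteMoment p (κ y)) (hlm : ∀ᵐ y ∂μ, HasFiniteMoment p (l y))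
    (hfin : ∫⁻ y, ∫⁻ u, edist u (T (y, u)) ^ p ∂(κ y) ∂μ ≠ ⊤)
    (hopt : ∀ σ : Kernel Y (U × U), IsMarkovKernel σ →
      (∀ᵐ y ∂μ, σ y ∈ couplings (κ y) (l y)) →
      ∫⁻ y, ∫⁻ u, edist u (T (y, u)) ^ p ∂(κ y) ∂μ ≤ ∫⁻ y, planCost p (σ y) ∂μ) :
    ∀ᵐ y ∂μ, ∫⁻ u, edist u (T (y, u)) ^ p ∂(κ y) ≤ wasserstein p (κ y) (l y) ^ p := by
  classical
  set G : Kernel Y (U × U) := mapKernel κ (fun v => (v.2, T v)) with hG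
  have hGm : Measurable fun v : Y × U => (v.2, T v) := by fun_prop
  have : IsMarkovKernel G := isMarkovKernel_mapKernel hGm
  have hGcost : ∀ y, planCost p (G y) = ∫⁻ u, edist u (T (y, u)) ^ p ∂(κ y) := by
    intro y
    rw [hG, mapKernel_apply hGm]
    exact planCost_map_prodMk measurable_id (by fun_prop)
  have hGcoup : ∀ᵐ y ∂μ, G y ∈ couplings (κ y) (l y) := by
    filter_upwards [hl] with y hy
    have := map_prodMk_mem_couplings (P := κ y) (f := id) (g := fun u => T (y, u))
      measurable_id (by fun_prop)
    rw [Measure.map_id, ← hy] at this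
    rw [hG, mapKernel_apply hGm]
    exact this
  simp_rw [← hGcost] at hfin hopt ⊢
  obtain ⟨H, hH, hdense⟩ := exists_countable_fillPlan U hp
  set F : ℕ → Kernel Y (U × U) := fun n => fillKernel κ l (H n) with hF
  set E : ℕ → Set Y := fun n =>
    {y | IsSubplanDensity (κ y) (l y) (H n)} ∩ {y | planCost p (F n y) < planCost p (G y)} with hE
  have hEm : ∀ n, MeasurableSet (E n) := fun n =>
    (measurableSet_isSubplanDensity (hH n)).inter
      (measurableSet_lt (measurable_planCost_kernel _) (measurable_planCost_kernel _))
  have hFcoup : ∀ n, ∀ y ∈ E n, F n y ∈ couplings (κ y) (l y) := by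
    intro n y hy
    rw [hF]
    simp only [fillKernel_apply (hH n)]
    exact IsSubplanDensity.fillPlan_mem_couplings (hH n) hy.1
  have hnull : ∀ n, μ (E n) = 0 := by
    intro n
    by_contra hpos
    -- The competitor uses the `n`-th completed plan on `E n` and the map `T` elsewhere.
    set σ : Kernel Y (U × U) := Kernel.piecewise (hEm n) (F n) G with hσ
    have hσM : IsMarkovKernel σ := by
      refine ⟨fun y => ?_⟩
      rw [hσ, Kernel.piecewise_apply]
      split_ifs with hy
      · exact isProbabilityMeasure_of_mem_couplings (hFcoup n y hy)
      · infer_instance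
    have hσc : ∀ᵐ y ∂μ, σ y ∈ couplings (κ y) (l y) := by
      filter_upwards [hGcoup] with y hy
      rw [hσ, Kernel.piecewise_apply]
      split_ifs with hy'
      · exact hFcoup n y hy'
      · exact hy
    have hle : ∀ y, planCost p (σ y) ≤ planCost p (G y) := by
      intro y
      rw [hσ, Kernel.piecewise_apply]
      split_ifs with hy'
      · exact hy'.2.le
      · exact le_rfl
    refine absurd (hopt σ hσM hσc) (not_le.2 ?_)
    refine lintegral_strict_mono_of_ae_le_of_ae_lt_on (s := E n)
      (measurable_planCost_kernel _).aemeasurable ?_ (ae_of_all _ hle) hpos ?_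
    · exact ne_top_of_le_ne_top hfin (lintegral_mono hle)
    · refine ae_of_all _ fun y hy => ?_
      rw [hσ, Kernel.piecewise_apply, if_pos hy]
      exact hy.2
  have hnot : ∀ᵐ y ∂μ, ∀ n, y ∉ E n :=
    ae_all_iff.2 fun n => measure_eq_zero_iff_ae_notMem.1 (hnull n)
  filter_upwards [hnot, hκm, hlm] with y hy h₁ h₂
  rw [wasserstein_rpow (by linarith)]
  refine le_iInf₂ fun π hπ => ?_
  by_contra! hlt
  obtain ⟨n, hn₁, hn₂⟩ := hdense (κ y) (l y) h₁ h₂ π hπ _ hlt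
  exact hy n ⟨hn₁, by simpa only [hF, fillKernel_apply (hH n), mem_ofPred_eq] using hn₂⟩

end Fibre

/-! ### Disintegration over the base and the geodesic property -/

section Norm

variable {Y U : Type*} [NormedAddCommGroup Y] [NormedAddCommGroup U]

theorem enorm_toLp_zero (u : U) : ‖(WithLp.toLp 2 ((0 : Y), u) : Joint Y U)‖ₑ = ‖u‖ₑ := by
  simp [enorm_eq_nnnorm]

theorem edist_toLp_same (y : Y) (u u' : U) :
    edist (WithLp.toLp 2 (y, u) : Joint Y U) (WithLp.toLp 2 (y, u')) = edist u u' := by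
  rw [edist_eq_enorm_sub, ← WithLp.toLp_sub, Prod.mk_sub_mk, sub_self, enorm_toLp_zero,
    edist_eq_enorm_sub]

end Norm

section Lift

set_option linter.unusedSectionVars false

variable {Y U : Type*}
  [NormedAddCommGroup Y] [InnerProductSpace ℝ Y] [CompleteSpace Y] [SecondCountableTopology Y]
  [MeasurableSpace Y] [BorelSpace Y]
  [NormedAddCommGroup U] [InnerProductSpace ℝ U] [CompleteSpace U] [SecondCountableTopology U]
  [MeasurableSpace U] [BorelSpace U]
  {p : ℝ} {μ : ProbabilityMeasure Y} {η ν : ProbabilityMeasure (Joint Y U)} {TU : Y × U → U}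

instance isProbabilityMeasure_map_ofLp :
    IsProbabilityMeasure ((η : Measure (Joint Y U)).map (WithLp.ofLp : Joint Y U → Y × U)) :=
  Measure.isProbabilityMeasure_map (by fun_prop)

variable (η) in
/-- The conditional measures of `η`, as a Markov kernel. -/
def condKer : Kernel Y U :=
  ((η : Measure (Joint Y U)).map (WithLp.ofLp : Joint Y U → Y × U)).condKernel

instance : IsMarkovKernel (condKer η) := by unfold condKer; infer_instance

instance : ((η : Measure (Joint Y U)).map (WithLp.ofLp : Joint Y U → Y × U)).IsCondKernel
    (condKer η) := by unfold condKer; infer_instance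

theorem compProd_condKer (hη : (η : Measure (Joint Y U)).map (fun z => z.fst) = μ) :
    (μ : Measure Y) ⊗ₘ condKer η =
      (η : Measure (Joint Y U)).map (WithLp.ofLp : Joint Y U → Y × U) := by
  have h := Measure.disintegrate
    ((η : Measure (Joint Y U)).map (WithLp.ofLp : Joint Y U → Y × U)) (condKer η)
  rwa [Measure.fst, Measure.map_map (by fun_prop) (by fun_prop),
    show (Prod.fst ∘ WithLp.ofLp : Joint Y U → Y) = fun z => z.fst from rfl, hη] at h

theorem lintegral_joint (hη : (η : Measure (Joint Y U)).map (fun z => z.fst) = μ)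
    {F : Joint Y U → ℝ≥0∞} (hF : Measurable F) :
    ∫⁻ z, F z ∂(η : Measure (Joint Y U)) =
      ∫⁻ y, ∫⁻ u, F (WithLp.toLp 2 (y, u)) ∂(condKer η y) ∂(μ : Measure Y) := by
  have hF' : Measurable fun w : Y × U => F (WithLp.toLp 2 w) := by fun_prop
  rw [← Measure.lintegral_compProd (f := fun w : Y × U => F (WithLp.toLp 2 w)) hF',
    compProd_condKer hη, lintegral_map hF' (by fun_prop)]

theorem ae_hasFiniteMoment_condKer (hp : 0 ≤ p) (hη : η ∈ condSpace p μ) :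
    ∀ᵐ y ∂(μ : Measure Y), HasFiniteMoment p (condKer η y) := by
  have h : ∫⁻ z : Joint Y U, ‖z.snd‖ₑ ^ p ∂(η : Measure (Joint Y U)) ≠ ⊤ :=
    ne_top_of_le_ne_top (LT.lt.ne hη.1)
      (lintegral_mono fun z => ENNReal.rpow_le_rpow (WithLp.enorm_snd_le _ z) hp)
  rw [lintegral_joint hη.2 (by fun_prop)] at h
  refine ae_lt_top ?_ h
  have : Measurable fun u : U => ‖u‖ₑ ^ p := by fun_prop
  exact this.lintegral_kernel

/-- The conditional measures of the image of `η` under a triangular map are the images of the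
conditional measures of `η`. -/
theorem condKer_map_triangular {γ : ProbabilityMeasure (Joint Y U)} {S : Y × U → U}
    (hη : (η : Measure (Joint Y U)).map (fun z => z.fst) = μ) (hS : Measurable S)
    (hγ : (γ : Measure (Joint Y U)) = (η : Measure (Joint Y U)).map (triMap S)) :
    ∀ᵐ y ∂(μ : Measure Y), condKer γ y = (condKer η y).map fun u => S (y, u) := by
  have hfst : ((γ : Measure (Joint Y U)).map (WithLp.ofLp : Joint Y U → Y × U)).fst = μ := by
    rw [hγ, Measure.fst, Measure.map_map (by fun_prop) (by fun_prop),
      Measure.map_map (by fun_prop) (measurable_triMap hS), ← hη]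
    rfl
  have := isMarkovKernel_mapKernel (κ := condKer η) hS
  have heq := eq_condKernel_of_measure_eq_compProd
    (ρ := (γ : Measure (Joint Y U)).map (WithLp.ofLp : Joint Y U → Y × U))
    (mapKernel (condKer η) S) ?_
  · rw [hfst] at heq
    filter_upwards [heq] with y hy
    rw [← mapKernel_apply hS, hy]
    rfl
  · rw [hfst]
    refine Measure.ext_of_lintegral _ fun f hf => ?_
    rw [hγ, Measure.map_map (by fun_prop) (measurable_triMap hS),
      lintegral_map hf ((WithLp.measurable_ofLp 2 _).comp (measurable_triMap hS)),
      Measure.lintegral_compProd hf]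
    have hm := measurable_triMap (Y := Y) (U := U) hS
    rw [lintegral_joint hη (F := fun z => f ((WithLp.ofLp ∘ triMap S) z)) (by fun_prop)]
    refine lintegral_congr fun y => ?_
    rw [mapKernel_apply hS, lintegral_map (by fun_prop) (by fun_prop)]
    rfl

/-- A measurable family of couplings of the conditional measures defines a triangular coupling. -/
theorem exists_triangularCoupling (hη : (η : Measure (Joint Y U)).map (fun z => z.fst) = μ)
    (hν : (ν : Measure (Joint Y U)).map (fun z => z.fst) = μ) (σ : Kernel Y (U × U))
    [IsMarkovKernel σ]
    (hσ : ∀ᵐ y ∂(μ : Measure Y), σ y ∈ couplings (condKer η y) (condKer ν y)) :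
    ∃ π ∈ triangularCouplings η ν, planCost p π = ∫⁻ y, planCost p (σ y) ∂(μ : Measure Y) := by
  set f : Y × U × U → Joint Y U := fun w => WithLp.toLp 2 (w.1, w.2.1) with hf
  set g : Y × U × U → Joint Y U := fun w => WithLp.toLp 2 (w.1, w.2.2) with hg
  have hfm : Measurable f := by fun_prop
  have hgm : Measurable g := by fun_prop
  have e₁ : ((μ : Measure Y) ⊗ₘ σ).map f = η := by
    refine Measure.ext_of_lintegral _ fun F hF => ?_
    rw [lintegral_map hF hfm, Measure.lintegral_compProd (by fun_prop), lintegral_joint hη hF]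
    refine lintegral_congr_ae ?_
    filter_upwards [hσ] with y hy
    exact lintegral_fst_of_mem_couplings hy (f := fun u => F (WithLp.toLp 2 (y, u))) (by fun_prop)
  have e₂ : ((μ : Measure Y) ⊗ₘ σ).map g = ν := by
    refine Measure.ext_of_lintegral _ fun F hF => ?_
    rw [lintegral_map hF hgm, Measure.lintegral_compProd (by fun_prop), lintegral_joint hν hF]
    refine lintegral_congr_ae ?_
    filter_upwards [hσ] with y hy
    exact lintegral_snd_of_mem_couplings hy (f := fun u => F (WithLp.toLp 2 (y, u))) (by fun_prop)
  refine ⟨((μ : Measure Y) ⊗ₘ σ).map fun w => (f w, g w), ⟨?_, ?_⟩, ?_⟩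
  · have := map_prodMk_mem_couplings (P := (μ : Measure Y) ⊗ₘ σ) hfm hgm
    rwa [e₁, e₂] at this
  · rw [ae_map_iff (by fun_prop) (measurableSet_eq_fun (by fun_prop) (by fun_prop))]
    exact ae_of_all _ fun w => rfl
  · rw [planCost_map_prodMk hfm hgm, Measure.lintegral_compProd (by fun_prop)]
    refine lintegral_congr fun y => ?_
    simp only [hf, hg, edist_toLp_same, planCost]

/-- The cost of the plan induced by a triangular map is the average of the costs on the fibres. -/
theorem planCost_graph_triMap (hη : (η : Measure (Joint Y U)).map (fun z => z.fst) = μ)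
    (hTU : Measurable TU) :
    planCost p ((η : Measure (Joint Y U)).map fun z => (z, triMap TU z)) =
      ∫⁻ y, ∫⁻ u, edist u (TU (y, u)) ^ p ∂(condKer η y) ∂(μ : Measure Y) := by
  have hm := measurable_triMap (Y := Y) (U := U) hTU
  rw [planCost_map_prodMk (f := fun z => z) measurable_id hm, lintegral_joint hη (by fun_prop)]
  refine lintegral_congr fun y => lintegral_congr fun u => ?_
  exact congrArg (· ^ p) (edist_toLp_same y u _)

theorem lintegral_edist_triMap_lt_top (hp : 1 ≤ p)
    (hη : HasFiniteMoment p (η : Measure (Joint Y U)))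
    (hν : HasFiniteMoment p (ν : Measure (Joint Y U))) (hTU : Measurable TU)
    (hT : (η : Measure (Joint Y U)).map (triMap TU) = ν) :
    ∫⁻ z, edist z (triMap TU z) ^ p ∂(η : Measure (Joint Y U)) < ⊤ := by
  have hm := measurable_triMap (Y := Y) (U := U) hTU
  have hν' : ∫⁻ z, ‖triMap TU z‖ₑ ^ p ∂(η : Measure (Joint Y U)) < ⊤ := by
    rw [HasFiniteMoment, ← hT, lintegral_map (by fun_prop) hm] at hν
    exact hν
  have hle : ∫⁻ z, edist z (triMap TU z) ^ p ∂(η : Measure (Joint Y U)) ≤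
      ∫⁻ z, 2 ^ (p - 1) * (‖z‖ₑ ^ p + ‖triMap TU z‖ₑ ^ p) ∂(η : Measure (Joint Y U)) := by
    refine lintegral_mono fun z => ?_
    refine le_trans ?_ (ENNReal.rpow_add_le_mul_rpow_add_rpow _ _ hp)
    gcongr
    rw [edist_eq_enorm_sub]
    exact enorm_sub_le
  refine hle.trans_lt ?_
  rw [lintegral_const_mul _ (by fun_prop), lintegral_add_left (by fun_prop)]
  exact ENNReal.mul_lt_top (ENNReal.rpow_lt_top_of_nonneg (by linarith) (by simp))
    (ENNReal.add_lt_top.2 ⟨hη, hν'⟩)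

/-- The averaged optimality of a triangular transport map implies its optimality on almost every
fibre. -/
theorem ae_cost_le_wasserstein_condKer (hp : 1 ≤ p) (hη : η ∈ condSpace p μ)
    (hν : ν ∈ condSpace p μ) (hTU : Measurable TU)
    (hT : (η : Measure (Joint Y U)).map (triMap TU) = ν)
    (hopt : IsOptimalTriangularCoupling p η ν
      ((η : Measure (Joint Y U)).map fun z => (z, triMap TU z))) :
    ∀ᵐ y ∂(μ : Measure Y), ∫⁻ u, edist u (TU (y, u)) ^ p ∂(condKer η y) ≠ ⊤ ∧
      condKer ν y = (condKer η y).map (fun u => TU (y, u)) ∧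
      ∫⁻ u, edist u (TU (y, u)) ^ p ∂(condKer η y) ≤
        wasserstein p (condKer η y) (condKer ν y) ^ p := by
  have hm := measurable_triMap (Y := Y) (U := U) hTU
  have hmap := condKer_map_triangular hη.2 hTU hT.symm
  have hcost := planCost_graph_triMap (p := p) hη.2 hTU
  have hfin : planCost p ((η : Measure (Joint Y U)).map fun z => (z, triMap TU z)) ≠ ⊤ := by
    rw [planCost_map_prodMk (f := fun z => z) measurable_id hm]
    exact (lintegral_edist_triMap_lt_top hp hη.1 hν.1 hTU hT).ne
  rw [hcost] at hfin
  have hfin' := ae_lt_top (by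
    have : Measurable fun w : Y × U => edist w.2 (TU w) ^ p := by fun_prop
    exact this.lintegral_kernel_prod_right') hfin
  have hmain := ae_cost_le_wasserstein hp hTU hmap
    (ae_hasFiniteMoment_condKer (by linarith) hη) (ae_hasFiniteMoment_condKer (by linarith) hν)
    hfin (by
      intro σ _ hσ
      obtain ⟨π, hπ, hπc⟩ := exists_triangularCoupling (p := p) hη.2 hν.2 σ hσ
      rw [← hπc, ← hcost]
      exact hopt.2 π hπ)
  filter_upwards [hfin', hmap, hmain] with y h₁ h₂ h₃ using ⟨h₁.ne, h₂, h₃⟩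

theorem interp_eq_triMap (TU : Y × U → U) (t : ℝ) :
    interp TU t = triMap fun w => (1 - t) • w.2 + t • TU w := by
  ext z
  refine WithLp.ofLp_injective 2 (Prod.ext ?_ ?_)
  · simp only [interp, triMap, WithLp.ofLp_add, WithLp.ofLp_smul, Prod.fst_add, Prod.smul_fst]
    exact (add_smul _ _ _).symm.trans (by rw [sub_add_cancel, one_smul]; rfl)
  · rfl

theorem coe_mccann (hTU : Measurable TU) (t : ℝ) :
    (mccann η TU hTU t : Measure (Joint Y U)) = (η : Measure (Joint Y U)).map (interp TU t) :=
  rfl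

theorem mccann_mem_condSpace (hp : 1 ≤ p) (hη : η ∈ condSpace p μ) (hν : ν ∈ condSpace p μ)
    (hTU : Measurable TU) (hT : (η : Measure (Joint Y U)).map (triMap TU) = ν) (t : ℝ) :
    mccann η TU hTU t ∈ condSpace p μ := by
  have hm := measurable_triMap (Y := Y) (U := U) hTU
  have hmt := measurable_interp (Y := Y) (U := U) hTU t
  refine ⟨?_, ?_⟩
  · have hν' : ∫⁻ z, ‖triMap TU z‖ₑ ^ p ∂(η : Measure (Joint Y U)) < ⊤ := by
      have := hν.1
      rw [HasFiniteMoment, ← hT, lintegral_map (by fun_prop) hm] at this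
      exact this
    rw [HasFiniteMoment, coe_mccann, lintegral_map (by fun_prop) hmt]
    have hle : ∫⁻ z, ‖interp TU t z‖ₑ ^ p ∂(η : Measure (Joint Y U)) ≤
        ∫⁻ z, 2 ^ (p - 1) * (‖1 - t‖ₑ ^ p * ‖z‖ₑ ^ p + ‖t‖ₑ ^ p * ‖triMap TU z‖ₑ ^ p)
          ∂(η : Measure (Joint Y U)) := by
      refine lintegral_mono fun z => ?_
      rw [← ENNReal.mul_rpow_of_nonneg _ _ (by linarith),
        ← ENNReal.mul_rpow_of_nonneg _ _ (by linarith), ← enorm_smul, ← enorm_smul]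
      refine le_trans ?_ (ENNReal.rpow_add_le_mul_rpow_add_rpow _ _ hp)
      gcongr
      exact enorm_add_le _ _
    refine hle.trans_lt ?_
    rw [lintegral_const_mul _ (by fun_prop), lintegral_add_left (by fun_prop),
      lintegral_const_mul _ (by fun_prop), lintegral_const_mul _ (by fun_prop)]
    have h2 : ∀ x : ℝ, ‖x‖ₑ ^ p < ⊤ := fun x =>
      ENNReal.rpow_lt_top_of_nonneg (by linarith) (by simp)
    exact ENNReal.mul_lt_top (ENNReal.rpow_lt_top_of_nonneg (by linarith) (by simp))
      (ENNReal.add_lt_top.2 ⟨ENNReal.mul_lt_top (h2 _) hη.1, ENNReal.mul_lt_top (h2 _) hν'⟩)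
  · rw [coe_mccann, Measure.map_map (by fun_prop) hmt, interp_eq_triMap, ← hη.2]
    rfl

theorem mccann_zero (hTU : Measurable TU) : mccann η TU hTU 0 = η := by
  refine Subtype.ext ?_
  change (mccann η TU hTU 0 : Measure (Joint Y U)) = η
  rw [coe_mccann, show (interp TU 0 : Joint Y U → Joint Y U) = id by ext z; simp [interp],
    Measure.map_id]

theorem mccann_one (hTU : Measurable TU)
    (hT : (η : Measure (Joint Y U)).map (triMap TU) = ν) : mccann η TU hTU 1 = ν := by
  refine Subtype.ext ?_
  change (mccann η TU hTU 1 : Measure (Joint Y U)) = ν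
  rw [coe_mccann, show (interp TU 1 : Joint Y U → Joint Y U) = triMap TU by ext z; simp [interp],
    hT]

/-- The fibrewise geodesic identity integrates over the base. No measurability of the fibrewise
distances is needed, because the two integrands are proportional almost everywhere. -/
theorem condWasserstein_mccann (hp : 1 ≤ p) (hη : η ∈ condSpace p μ)
    (hν : ν ∈ condSpace p μ) (hTU : Measurable TU)
    (hT : (η : Measure (Joint Y U)).map (triMap TU) = ν)
    (hopt : IsOptimalTriangularCoupling p η ν
      ((η : Measure (Joint Y U)).map fun z => (z, triMap TU z)))
    {s t : ℝ} (hs : 0 ≤ s) (hst : s ≤ t) (ht : t ≤ 1) :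
    condWasserstein p μ (mccann η TU hTU s) (mccann η TU hTU t) =
      ENNReal.ofReal (t - s) * condWasserstein p μ η ν := by
  have hp0 : 0 < p := by linarith
  have hcond : ∀ r : ℝ, ∀ᵐ y ∂(μ : Measure Y), condKer (mccann η TU hTU r) y =
      (condKer η y).map fun u => (1 - r) • u + r • TU (y, u) := by
    intro r
    refine condKer_map_triangular (S := fun w => (1 - r) • w.2 + r • TU w) hη.2 (by fun_prop) ?_
    rw [coe_mccann, interp_eq_triMap]
  have hfib : ∀ᵐ y ∂(μ : Measure Y),
      wasserstein p (conditional (mccann η TU hTU s) y) (conditional (mccann η TU hTU t) y) ^ p =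
        ENNReal.ofReal (t - s) ^ p * wasserstein p (conditional η y) (conditional ν y) ^ p := by
    filter_upwards [hcond s, hcond t, ae_cost_le_wasserstein_condKer hp hη hν hTU hT hopt]
      with y h₁ h₂ ⟨h₃, h₄, h₅⟩
    change wasserstein p (condKer _ y) (condKer _ y) ^ p =
      _ * wasserstein p (condKer η y) (condKer ν y) ^ p
    rw [h₄] at h₅
    rw [h₁, h₂, h₄, wasserstein_interpolation hp (by fun_prop) h₃ h₅ hs hst ht,
      ENNReal.mul_rpow_of_nonneg _ _ hp0.le]
  rw [condWasserstein, lintegral_congr_ae hfib, lintegral_const_mul' _ _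
    (ENNReal.rpow_ne_top_of_nonneg hp0.le ENNReal.ofReal_ne_top),
    ENNReal.mul_rpow_of_nonneg _ _ (by positivity), ← ENNReal.rpow_mul,
    mul_one_div_cancel hp0.ne', ENNReal.rpow_one]
  rfl

theorem condWasserstein_ne_top (hp : 1 ≤ p) (hη : η ∈ condSpace p μ)
    (hν : ν ∈ condSpace p μ) (hTU : Measurable TU)
    (hT : (η : Measure (Joint Y U)).map (triMap TU) = ν) :
    condWasserstein p μ η ν ≠ ⊤ := by
  have hp0 : 0 < p := by linarith
  have hm := measurable_triMap (Y := Y) (U := U) hTU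
  have hfin := (lintegral_edist_triMap_lt_top hp hη.1 hν.1 hTU hT).ne
  rw [← planCost_map_prodMk (f := fun z => z) measurable_id hm,
    planCost_graph_triMap hη.2 hTU] at hfin
  refine ENNReal.rpow_ne_top_of_nonneg (by positivity) (ne_top_of_le_ne_top hfin ?_)
  refine lintegral_mono_ae ?_
  filter_upwards [condKer_map_triangular hη.2 hTU hT.symm] with y hy
  change wasserstein p (condKer η y) (condKer ν y) ^ p ≤ _
  have hTy : Measurable fun u => TU (y, u) := by fun_prop
  have hc := map_prodMk_mem_couplings (P := condKer η y) (f := fun u => u) measurable_id hTy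
  rw [← hy, show (condKer η y).map (fun u => u) = condKer η y from Measure.map_id] at hc
  rw [wasserstein_rpow hp0]
  refine (iInf₂_le _ hc).trans (le_of_eq ?_)
  exact planCost_map_prodMk measurable_id hTy

theorem isACCurve_of_isConstantSpeedGeodesic {γ : ℝ → ProbabilityMeasure (Joint Y U)}
    (hγ : IsConstantSpeedGeodesic p μ η ν γ) (hfin : condWasserstein p μ η ν ≠ ⊤) :
    IsACCurve p μ 0 1 γ := by
  refine ⟨hγ.1, fun _ => (condWasserstein p μ η ν).toReal, by simp, fun s t hs hst ht => ?_⟩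
  rw [hγ.2.2.2 s t hs hst ht, intervalIntegral.integral_const, smul_eq_mul,
    ENNReal.ofReal_mul (by linarith), ENNReal.ofReal_toReal hfin]

end Lift

/-! ### Injectivity of the interpolating maps and the velocity field -/

section Convex

variable {E : Type*} [NormedAddCommGroup E] [NormedSpace ℝ E] [StrictConvexSpace ℝ E] {p : ℝ}

theorem norm_combo_rpow_lt (hp : 1 < p) {a b : ℝ} {x y : E} (hxy : x ≠ y) (ha : 0 < a) (hb : 0 < b)
    (hab : a + b = 1) : ‖a • x + b • y‖ ^ p < a * ‖x‖ ^ p + b * ‖y‖ ^ p := by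
  rcases eq_or_ne ‖x‖ ‖y‖ with h | h
  · have h1 := norm_combo_lt_of_ne h.le le_rfl hxy ha hb hab
    have h2 := Real.rpow_lt_rpow (norm_nonneg _) h1 (by linarith : 0 < p)
    rwa [h, ← add_mul, hab, one_mul]
  · have h1 : ‖a • x + b • y‖ ≤ a * ‖x‖ + b * ‖y‖ := by
      refine (norm_add_le _ _).trans (le_of_eq ?_)
      rw [norm_smul, norm_smul, Real.norm_of_nonneg ha.le, Real.norm_of_nonneg hb.le]
    refine (Real.rpow_le_rpow (norm_nonneg _) h1 (by linarith)).trans_lt ?_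
    exact (strictConvexOn_rpow hp).2 (norm_nonneg x) (norm_nonneg y) h ha hb hab

/-- Two segments whose end points satisfy the cyclical monotonicity inequality cannot cross at the
same interior time unless they coincide: exchanging the end points would replace both displacements
by strict convex combinations of them. -/
theorem eq_of_combo_eq (hp : 1 < p) {t : ℝ} (ht0 : 0 < t) (ht1 : t < 1) {x₁ x₂ y₁ y₂ : E}
    (hc : ‖x₁ - y₁‖ ^ p + ‖x₂ - y₂‖ ^ p ≤ ‖x₁ - y₂‖ ^ p + ‖x₂ - y₁‖ ^ p)
    (h : (1 - t) • x₁ + t • y₁ = (1 - t) • x₂ + t • y₂) : x₁ = x₂ := by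
  have hx : x₁ - x₂ = t • ((x₁ - y₁) - (x₂ - y₂)) := by
    have : (1 - t) • x₁ + t • y₁ - ((1 - t) • x₂ + t • y₂) = 0 := sub_eq_zero.2 h
    rw [← sub_eq_zero, ← this]
    module
  by_contra hne
  have hd : x₁ - y₁ ≠ x₂ - y₂ := by
    intro hd
    rw [hd, sub_self, smul_zero, sub_eq_zero] at hx
    exact hne hx
  have e₁ : x₁ - y₂ = t • (x₁ - y₁) + (1 - t) • (x₂ - y₂) := by
    rw [← sub_eq_zero] at hx ⊢
    rw [← hx]
    module
  have e₂ : x₂ - y₁ = t • (x₂ - y₂) + (1 - t) • (x₁ - y₁) := by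
    rw [← sub_eq_zero] at hx ⊢
    rw [← neg_eq_zero, ← hx]
    module
  have h₁ := norm_combo_rpow_lt hp hd ht0 (by linarith : 0 < 1 - t) (by ring)
  have h₂ := norm_combo_rpow_lt hp hd.symm ht0 (by linarith : 0 < 1 - t) (by ring)
  rw [e₁, e₂] at hc
  linarith

end Convex

section Field

set_option linter.unusedSectionVars false

variable {Y U : Type*}
  [NormedAddCommGroup Y] [InnerProductSpace ℝ Y] [CompleteSpace Y] [SecondCountableTopology Y]
  [MeasurableSpace Y] [BorelSpace Y]
  [NormedAddCommGroup U] [InnerProductSpace ℝ U] [CompleteSpace U] [SecondCountableTopology U]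
  [MeasurableSpace U] [BorelSpace U]
  {p : ℝ} {μ : ProbabilityMeasure Y} {η ν : ProbabilityMeasure (Joint Y U)} {TU : Y × U → U}

/-- Almost every point of the graph of a map lies in the support of the conditional plan it
induces on its fibre. -/
theorem ae_mem_support_graph (hη : (η : Measure (Joint Y U)).map (fun z => z.fst) = μ)
    (hTU : Measurable TU) :
    ∀ᵐ z ∂(η : Measure (Joint Y U)), ∀ V : Set (U × U), IsOpen V →
      (z.snd, TU (z.fst, z.snd)) ∈ V →
        (condKer η z.fst).map (fun u => (u, TU (z.fst, u))) V ≠ 0 := by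
  have hGm : Measurable fun v : Y × U => (v.2, TU v) := by fun_prop
  set G := mapKernel (condKer η) (fun v : Y × U => (v.2, TU v)) with hG
  have hbasis : ∀ B ∈ TopologicalSpace.countableBasis (U × U), ∀ᵐ z ∂(η : Measure (Joint Y U)),
      (z.snd, TU (z.fst, z.snd)) ∈ B → G z.fst B ≠ 0 := by
    intro B hB
    have hBm : MeasurableSet B := (TopologicalSpace.isOpen_of_mem_countableBasis hB).measurableSet
    have hprod : ∀ᵐ v ∂((η : Measure (Joint Y U)).map (WithLp.ofLp : Joint Y U → Y × U)),
        (v.2, TU v) ∈ B → G v.1 B ≠ 0 := by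
      rw [← compProd_condKer hη]
      refine Measure.ae_compProd_of_ae_ae ?_ (ae_of_all _ fun y => ?_)
      · have h₁ : MeasurableSet {v : Y × U | (v.2, TU v) ∈ B} := hGm hBm
        have h₂ : MeasurableSet {v : Y × U | G v.1 B = 0} :=
          ((G.measurable_coe hBm).comp measurable_fst) (measurableSet_singleton 0)
        convert h₁.compl.union h₂.compl using 1
        ext v
        simp [imp_iff_not_or]
      · by_cases h0 : G y B = 0
        · have h0' := h0
          rw [hG, mapKernel_apply hGm, Measure.map_apply (by fun_prop) hBm] at h0'
          filter_upwards [measure_eq_zero_iff_ae_notMem.1 h0'] with u hu h using absurd h hu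
        · exact ae_of_all _ fun u _ => h0
    exact ae_of_ae_map (by fun_prop) hprod
  filter_upwards [(ae_ball_iff (TopologicalSpace.countable_countableBasis (U × U))).2 hbasis]
    with z hz V hV hzV
  obtain ⟨B, hB, hzB, hBV⟩ :=
    (TopologicalSpace.isBasis_countableBasis (U × U)).exists_subset_of_mem_open hzV hV
  intro h0
  refine hz B hB hzB ?_
  rw [hG, mapKernel_apply hGm]
  exact measure_mono_null hBV h0

/-- An optimal triangular transport map satisfies, on a set of full measure, the two-point
cyclical monotonicity inequality on each fibre. -/
theorem exists_monotone_set (hp : 1 ≤ p) (hη : η ∈ condSpace p μ)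
    (hν : ν ∈ condSpace p μ) (hTU : Measurable TU)
    (hT : (η : Measure (Joint Y U)).map (triMap TU) = ν)
    (hopt : IsOptimalTriangularCoupling p η ν
      ((η : Measure (Joint Y U)).map fun z => (z, triMap TU z))) :
    ∃ Z : Set (Joint Y U), MeasurableSet Z ∧ (∀ᵐ z ∂(η : Measure (Joint Y U)), z ∈ Z) ∧
      ∀ y u₁ u₂, WithLp.toLp 2 (y, u₁) ∈ Z → WithLp.toLp 2 (y, u₂) ∈ Z →
        ‖u₁ - TU (y, u₁)‖ ^ p + ‖u₂ - TU (y, u₂)‖ ^ p ≤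
          ‖u₁ - TU (y, u₂)‖ ^ p + ‖u₂ - TU (y, u₁)‖ ^ p := by
  have hp0 : 0 < p := by linarith
  have hfib := ae_cost_le_wasserstein_condKer hp hη hν hTU hT hopt
  rw [← hη.2] at hfib
  have hboth := (ae_of_ae_map (by fun_prop) hfib).and (ae_mem_support_graph hη.2 hTU)
  obtain ⟨Z, hZ, hZm, hZgood⟩ := hboth.exists_measurable_mem
  refine ⟨Z, hZm, hZ, fun y u₁ u₂ h₁ h₂ => ?_⟩
  obtain ⟨⟨hfin, hmap, hW⟩, hs₁⟩ := hZgood _ h₁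
  obtain ⟨-, hs₂⟩ := hZgood _ h₂
  simp only [WithLp.toLp_fst, WithLp.toLp_snd] at hfin hmap hW hs₁ hs₂
  have hTy : Measurable fun u => TU (y, u) := by fun_prop
  have hc := map_prodMk_mem_couplings (P := condKer η y) (f := fun u => u) measurable_id hTy
  rw [← hmap, show (condKer η y).map (fun u => u) = condKer η y from Measure.map_id] at hc
  have hcost := planCost_map_prodMk (p := p) (P := condKer η y) (f := fun u => u)
    measurable_id hTy
  rw [← hcost] at hfin hW
  rw [wasserstein_rpow hp0] at hW
  have key := edist_rpow_add_le_of_optimal hc (fun π' hπ' => hW.trans (iInf₂_le _ hπ')) hfin hs₁ hs₂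
  have conv : ∀ a b : U, edist a b ^ p = ENNReal.ofReal (‖a - b‖ ^ p) := by
    intro a b
    rw [edist_dist, dist_eq_norm, ENNReal.ofReal_rpow_of_nonneg (norm_nonneg _) hp0.le]
  simp only [conv] at key
  rwa [← ENNReal.ofReal_add (by positivity) (by positivity),
    ← ENNReal.ofReal_add (by positivity) (by positivity),
    ENNReal.ofReal_le_ofReal_iff (by positivity)] at key

theorem measurable_uncurry_interp (hTU : Measurable TU) :
    Measurable fun q : ℝ × Joint Y U => interp TU q.1 q.2 := by
  have := measurable_triMap (Y := Y) (U := U) hTU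
  unfold interp
  fun_prop

/-- The velocity field is the displacement composed with the inverse of `(t, z) ↦ (t, T_t z)`,
which is injective on a Borel set of full measure, hence has Borel inverse by Lusin–Souslin. -/
theorem exists_velocity_field (hp : 1 < p) (hη : η ∈ condSpace p μ)
    (hν : ν ∈ condSpace p μ) (hTU : Measurable TU) (hinj : Function.Injective (triMap TU))
    (hT : (η : Measure (Joint Y U)).map (triMap TU) = ν)
    (hopt : IsOptimalTriangularCoupling p η ν
      ((η : Measure (Joint Y U)).map fun z => (z, triMap TU z))) :
    ∃ v : ℝ → Joint Y U → Joint Y U, IsTriangularField v ∧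
      ∀ᵐ z ∂(η : Measure (Joint Y U)), ∀ t ∈ Icc (0 : ℝ) 1,
        v t (interp TU t z) = displacement TU z := by
  obtain ⟨Z, hZm, hZ, hmono⟩ := exists_monotone_set hp.le hη hν hTU hT hopt
  have hinjt : ∀ t ∈ Icc (0 : ℝ) 1, ∀ z₁ ∈ Z, ∀ z₂ ∈ Z,
      interp TU t z₁ = interp TU t z₂ → z₁ = z₂ := by
    intro t ht z₁ hz₁ z₂ hz₂ h
    rcases eq_or_lt_of_le ht.1 with h0 | h0
    · subst h0
      simpa [interp] using h
    rcases eq_or_lt_of_le ht.2 with h1 | h1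
    -- Monotonicity says nothing at `t = 1`; there the injectivity of the transport map is used.
    · subst h1
      refine hinj ?_
      simpa [interp] using h
    rw [interp_eq_triMap] at h
    obtain ⟨y, u₁⟩ := z₁
    obtain ⟨y', u₂⟩ := z₂
    simp only [triMap, WithLp.toLp_fst, WithLp.toLp_snd, WithLp.toLp.injEq, Prod.mk.injEq] at h
    obtain ⟨rfl, h⟩ := h
    rw [eq_of_combo_eq hp h0 h1 (hmono y u₁ u₂ hz₁ hz₂) h]
  set S : Set (ℝ × Joint Y U) := Icc (0 : ℝ) 1 ×ˢ Z with hS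
  have hSm : MeasurableSet S := measurableSet_Icc.prod hZm
  have : StandardBorelSpace S := hSm.standardBorel
  set Φ : S → ℝ × Joint Y U := fun q => (q.1.1, interp TU q.1.1 q.1.2) with hΦ
  have hΦm : Measurable Φ :=
    (measurable_fst.prodMk (measurable_uncurry_interp hTU)).comp measurable_subtype_coe
  have hΦi : Function.Injective Φ := by
    intro q q' h
    have h₁ : q.1.1 = q'.1.1 := (Prod.ext_iff.1 h).1
    have h₂ : interp TU q.1.1 q.1.2 = interp TU q'.1.1 q'.1.2 := (Prod.ext_iff.1 h).2
    rw [← h₁] at h₂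
    exact Subtype.ext (Prod.ext h₁ (hinjt _ q.2.1 _ q.2.2 _ q'.2.2 h₂))
  have hemb : MeasurableEmbedding Φ := hΦm.measurableEmbedding hΦi
  obtain ⟨g, hg, hgΦ⟩ := hemb.exists_measurable_extend
    (g := fun q : S => TU (q.1.2.fst, q.1.2.snd) - q.1.2.snd)
    (by
      have h : Measurable fun z : Joint Y U => TU (z.fst, z.snd) - z.snd := by fun_prop
      exact h.comp (measurable_snd.comp measurable_subtype_coe)) (fun _ => inferInstance)
  refine ⟨fun t z => WithLp.toLp 2 (0, g (t, z)), ⟨fun t z => g (t, z), hg, fun _ _ => rfl⟩, ?_⟩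
  filter_upwards [hZ] with z hz t ht
  have := congrFun hgΦ ⟨(t, z), ht, hz⟩
  simp only [hΦ, Function.comp_apply] at this
  rw [this, displacement]

end Field

/-! ### The continuity equation -/

section Continuity

variable {X : Type*} [NormedAddCommGroup X] [InnerProductSpace ℝ X] {d : ℕ}

/-- The coordinate map `z ↦ (⟪e₁, z⟫, …, ⟪e_d, z⟫)`. -/
def coordMap (e : Fin d → X) : X →L[ℝ] (Fin d → ℝ) :=
  ContinuousLinearMap.pi fun i => innerSL ℝ (e i)

theorem coordMap_apply (e : Fin d → X) (z : X) :
    coordMap e z = fun i => inner ℝ (e i) z := by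
  ext i
  simp [coordMap]

variable {ψ : (Fin d → ℝ) × ℝ → ℝ} {e : Fin d → X}

/-- For a cylindrical function `φ(z, t) = ψ(L z, t)`, the expression `∂_t φ + ⟪w, ∇_z φ⟫` is the
derivative of `ψ` in the direction `(L w, 1)`. -/
theorem deriv_add_inner_gradient [CompleteSpace X] (hψ : ContDiff ℝ (⊤ : ℕ∞) ψ) {φ : X → ℝ → ℝ}
    (hφ : ∀ z t, φ z t = ψ (coordMap e z, t)) (z w : X) (t : ℝ) :
    deriv (fun s => φ z s) t + inner ℝ w (gradient (fun x => φ x t) z) =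
      fderiv ℝ ψ (coordMap e z, t) (coordMap e w, 1) := by
  have hd : HasFDerivAt ψ (fderiv ℝ ψ (coordMap e z, t)) (coordMap e z, t) :=
    (hψ.differentiable (by simp)).differentiableAt.hasFDerivAt
  have h₁ : HasDerivAt (fun s => φ z s) (fderiv ℝ ψ (coordMap e z, t) (0, 1)) t := by
    simp only [hφ]
    exact hd.comp_hasDerivAt t ((hasDerivAt_const t _).prodMk (hasDerivAt_id t))
  have h₂ : HasFDerivAt (fun x => φ x t)
      ((fderiv ℝ ψ (coordMap e z, t)).comp ((coordMap e).prod 0)) z := by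
    simp only [hφ]
    exact hd.comp z ((coordMap e).hasFDerivAt.prodMk (hasFDerivAt_const t z))
  rw [h₁.deriv, gradient, h₂.fderiv, real_inner_comm, InnerProductSpace.toDual_symm_apply,
    ContinuousLinearMap.comp_apply, ← map_add]
  congr 1
  simp

/-- The derivative of a cylindrical function along the segment from `z` to `w`. -/
theorem hasDerivAt_along_line (hψ : ContDiff ℝ (⊤ : ℕ∞) ψ) (z w : X) (t : ℝ) :
    HasDerivAt (fun s => ψ (coordMap e ((1 - s) • z + s • w), s))
      (fderiv ℝ ψ (coordMap e ((1 - t) • z + t • w), t) (coordMap e (w - z), 1)) t := by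
  have hd : HasFDerivAt ψ (fderiv ℝ ψ (coordMap e ((1 - t) • z + t • w), t))
      (coordMap e ((1 - t) • z + t • w), t) :=
    (hψ.differentiable (by simp)).differentiableAt.hasFDerivAt
  have h : HasDerivAt (fun s : ℝ => (1 - s) • z + s • w) (w - z) t := by
    have h₁ := (((hasDerivAt_id t).const_sub 1).smul_const z).add ((hasDerivAt_id t).smul_const w)
    refine h₁.congr_deriv ?_
    module
  exact hd.comp_hasDerivAt (f := fun s => (coordMap e ((1 - s) • z + s • w), s)) t
    (((coordMap e).hasFDerivAt.comp_hasDerivAt t h).prodMk (hasDerivAt_id t))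

theorem continuous_fderiv_apply (hψ : ContDiff ℝ (⊤ : ℕ∞) ψ) :
    Continuous fun q : ((Fin d → ℝ) × ℝ) × (Fin d → ℝ) × ℝ => fderiv ℝ ψ q.1 q.2 := by
  have : Continuous (fderiv ℝ ψ) := hψ.continuous_fderiv (by simp)
  fun_prop

theorem integral_fderiv_along_line (hψ : ContDiff ℝ (⊤ : ℕ∞) ψ)
    (hsupp : tsupport ψ ⊆ univ ×ˢ Ioo (0 : ℝ) 1) (z w : X) :
    ∫ t in Ioo (0 : ℝ) 1,
      fderiv ℝ ψ (coordMap e ((1 - t) • z + t • w), t) (coordMap e (w - z), 1) = 0 := by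
  have hc : Continuous fun t : ℝ =>
      fderiv ℝ ψ (coordMap e ((1 - t) • z + t • w), t) (coordMap e (w - z), 1) :=
    (continuous_fderiv_apply hψ).comp
      (f := fun t : ℝ => ((coordMap e ((1 - t) • z + t • w), t), (coordMap e (w - z), (1 : ℝ))))
      (by fun_prop)
  rw [← integral_Ioc_eq_integral_Ioo, ← intervalIntegral.integral_of_le zero_le_one,
    intervalIntegral.integral_eq_sub_of_hasDerivAt
      (fun t _ => hasDerivAt_along_line hψ z w t) (hc.intervalIntegrable 0 1)]
  have hz : ∀ (x : Fin d → ℝ) (t : ℝ), t ∉ Ioo (0 : ℝ) 1 → ψ (x, t) = 0 := fun x t ht =>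
    image_eq_zero_of_notMem_tsupport fun h => ht (hsupp h).2
  rw [hz _ _ (by simp), hz _ _ (by simp), sub_self]

variable [MeasurableSpace X] [BorelSpace X] [SecondCountableTopology X]
  {η : Measure X} [IsProbabilityMeasure η] {T : X → X} {v : ℝ → X → X}

/-- The fundamental theorem of calculus along the lines `t ↦ (1 - t) z + t T(z)`, integrated
against `η`. -/
theorem integral_integral_fderiv_along_line (hψ : ContDiff ℝ (⊤ : ℕ∞) ψ)
    (hcs : HasCompactSupport ψ) (hsupp : tsupport ψ ⊆ univ ×ˢ Ioo (0 : ℝ) 1)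
    (hT : Measurable T) (hD : Integrable (fun z => T z - z) η) :
    ∫ t in Ioo (0 : ℝ) 1, ∫ z, fderiv ℝ ψ (coordMap e ((1 - t) • z + t • T z), t)
      (coordMap e (T z - z), 1) ∂η = 0 := by
  obtain ⟨C, hC⟩ := (hcs.fderiv ℝ).exists_bound_of_continuous
    (hψ.continuous_fderiv (by simp))
  rw [integral_integral_swap]
  · simp_rw [integral_fderiv_along_line hψ hsupp]
    simp
  · have hbound : Integrable (fun q : ℝ × X => C * (‖coordMap e (T q.2 - q.2)‖ + 1))
        ((volume.restrict (Ioo (0 : ℝ) 1)).prod η) := by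
      have h₁ : Integrable (fun z => C * (‖coordMap e (T z - z)‖ + 1)) η :=
        ((((coordMap e).integrable_comp hD).norm).add (integrable_const 1)).const_mul C
      exact h₁.comp_snd _
    refine hbound.mono' ?_ (ae_of_all _ fun q => ?_)
    · have hm : Measurable fun q : ℝ × X => (((coordMap e ((1 - q.1) • q.2 + q.1 • T q.2), q.1),
          (coordMap e (T q.2 - q.2), (1 : ℝ))) : ((Fin d → ℝ) × ℝ) × (Fin d → ℝ) × ℝ) := by
        fun_prop
      exact ((continuous_fderiv_apply hψ).measurable.comp hm).aestronglyMeasurable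
    · refine (ContinuousLinearMap.le_opNorm _ _).trans ?_
      refine mul_le_mul (hC _) ?_ (norm_nonneg _) ((norm_nonneg _).trans (hC 0))
      rw [Prod.norm_mk, norm_one]
      exact max_le (by linarith) (by linarith [norm_nonneg (coordMap e (T q.2 - q.2))])

theorem measurable_lineMap (hT : Measurable T) :
    Measurable fun q : ℝ × X => (1 - q.1) • q.2 + q.1 • T q.2 := by
  fun_prop

/-- The displacement interpolation along `T` solves the continuity equation for every Borel field
which equals `T(z) - z` at the point `(1 - t) z + t T(z)`. -/
theorem solvesContinuityEquation_lineMap [CompleteSpace X] (hT : Measurable T)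
    (hD : Integrable (fun z => T z - z) η) (hv : Measurable (Function.uncurry v))
    (hvT : ∀ᵐ t ∂(volume.restrict (Ioo (0 : ℝ) 1)), ∀ᵐ z ∂η,
      v t ((1 - t) • z + t • T z) = T z - z) :
    SolvesContinuityEquation 0 1 (fun t => η.map fun z => (1 - t) • z + t • T z) v where
  curve_aemeasurable := by
    refine (Measure.measurable_of_measurable_coe _ fun s hs => ?_).aemeasurable
    have hms : ∀ t : ℝ, η.map (fun z => (1 - t) • z + t • T z) s =
        η (Prod.mk t ⁻¹' ((fun q : ℝ × X => (1 - q.1) • q.2 + q.1 • T q.2) ⁻¹' s)) := fun t => by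
      rw [Measure.map_apply (by fun_prop) hs]
      rfl
    simp_rw [hms]
    exact measurable_measure_prodMk_left (measurable_lineMap hT hs)
  field_measurable := hv
  field_integrable := by
    have hvt : ∀ t, Measurable (v t) := fun t => hv.comp measurable_prodMk_left
    have : ∫⁻ t in Ioo (0 : ℝ) 1, ∫⁻ z, ‖v t z‖ₑ ∂(η.map fun z => (1 - t) • z + t • T z) =
        ∫⁻ _ in Ioo (0 : ℝ) 1, ∫⁻ z, ‖T z - z‖ₑ ∂η := by
      refine lintegral_congr_ae ?_
      filter_upwards [hvT] with t ht
      rw [lintegral_map (hvt t).enorm (by fun_prop)]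
      refine lintegral_congr_ae ?_
      filter_upwards [ht] with z hz
      rw [hz]
    rw [this, lintegral_const]
    exact ENNReal.mul_lt_top hD.2 (by simp)
  weak := by
    rintro φ ⟨d, e, ψ, -, hψ, hcs, hsupp, hφ⟩
    have hφ' : ∀ z t, φ z t = ψ (coordMap e z, t) := fun z t => by rw [coordMap_apply, hφ]
    have hvt : ∀ t, Measurable (v t) := fun t => hv.comp measurable_prodMk_left
    refine Eq.trans (integral_congr_ae ?_)
      (integral_integral_fderiv_along_line (e := e) hψ hcs hsupp hT hD)
    filter_upwards [hvT] with t ht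
    simp_rw [deriv_add_inner_gradient (e := e) hψ hφ']
    have hm : Measurable fun z : X => (((coordMap e z, t), (coordMap e (v t z), (1 : ℝ))) :
        ((Fin d → ℝ) × ℝ) × (Fin d → ℝ) × ℝ) := by
      have := hvt t
      fun_prop
    have hsm : AEStronglyMeasurable
        (fun z => fderiv ℝ ψ (coordMap e z, t) (coordMap e (v t z), 1))
        (η.map fun z => (1 - t) • z + t • T z) :=
      ((continuous_fderiv_apply hψ).measurable.comp hm).aestronglyMeasurable
    rw [integral_map (by fun_prop) hsm]
    refine integral_congr_ae ?_
    filter_upwards [ht] with z hz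
    rw [hz]

end Continuity

section Main

set_option linter.unusedSectionVars false

variable {Y U : Type*}
  [NormedAddCommGroup Y] [InnerProductSpace ℝ Y] [CompleteSpace Y] [SecondCountableTopology Y]
  [MeasurableSpace Y] [BorelSpace Y]
  [NormedAddCommGroup U] [InnerProductSpace ℝ U] [CompleteSpace U] [SecondCountableTopology U]
  [MeasurableSpace U] [BorelSpace U]
  {p : ℝ} {μ : ProbabilityMeasure Y} {η ν : ProbabilityMeasure (Joint Y U)} {TU : Y × U → U}

theorem displacement_eq (TU : Y × U → U) (z : Joint Y U) :
    displacement TU z = triMap TU z - z := by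
  refine WithLp.ofLp_injective 2 (Prod.ext ?_ rfl)
  exact (sub_self _).symm

theorem IsTriangularField.measurable {v : ℝ → Joint Y U → Joint Y U} (hv : IsTriangularField v) :
    Measurable (Function.uncurry v) := by
  obtain ⟨vU, hvU, hv⟩ := hv
  have : Function.uncurry v =
      fun q => WithLp.toLp 2 ((0 : Y), Function.uncurry vU q) := by
    ext q
    exact hv q.1 q.2
  rw [this]
  fun_prop

theorem integrable_triMap_sub (hp : 1 ≤ p) (hη : HasFiniteMoment p (η : Measure (Joint Y U)))
    (hν : HasFiniteMoment p (ν : Measure (Joint Y U))) (hTU : Measurable TU)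
    (hT : (η : Measure (Joint Y U)).map (triMap TU) = ν) :
    Integrable (fun z => triMap TU z - z) (η : Measure (Joint Y U)) := by
  have hm := measurable_triMap (Y := Y) (U := U) hTU
  refine ⟨by fun_prop, ?_⟩
  have hle : ∫⁻ z, ‖triMap TU z - z‖ₑ ∂(η : Measure (Joint Y U)) ≤
      ∫⁻ z, (1 + edist z (triMap TU z) ^ p) ∂(η : Measure (Joint Y U)) := by
    refine lintegral_mono fun z => ?_
    rw [← edist_eq_enorm_sub, edist_comm]
    rcases le_total (edist z (triMap TU z)) 1 with h | h
    · exact h.trans le_self_add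
    · refine le_trans ?_ le_add_self
      simpa using ENNReal.rpow_le_rpow_of_exponent_le h hp
  refine hle.trans_lt ?_
  rw [lintegral_add_left measurable_const]
  exact ENNReal.add_lt_top.2
    ⟨by simp, lintegral_edist_triMap_lt_top hp hη hν hTU hT⟩

theorem solvesContinuityEquation_mccann (hp : 1 ≤ p)
    (hη : HasFiniteMoment p (η : Measure (Joint Y U)))
    (hν : HasFiniteMoment p (ν : Measure (Joint Y U))) (hTU : Measurable TU)
    (hT : (η : Measure (Joint Y U)).map (triMap TU) = ν) {v : ℝ → Joint Y U → Joint Y U}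
    (hv : IsTriangularField v)
    (hvT : ∀ᵐ t ∂(volume.restrict (Ioo (0 : ℝ) 1)), ∀ᵐ z ∂(η : Measure (Joint Y U)),
      v t (interp TU t z) = displacement TU z) :
    SolvesContinuityEquation 0 1
      (fun t => (mccann η TU hTU t : Measure (Joint Y U))) v :=
  solvesContinuityEquation_lineMap (measurable_triMap hTU)
    (integrable_triMap_sub hp hη hν hTU hT) hv.measurable
    (by simpa only [displacement_eq, interp] using hvT)

theorem isConstantSpeedGeodesic_mccann (hp : 1 ≤ p) (hη : η ∈ condSpace p μ)
    (hν : ν ∈ condSpace p μ) (hTU : Measurable TU)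
    (hT : (η : Measure (Joint Y U)).map (triMap TU) = ν)
    (hopt : IsOptimalTriangularCoupling p η ν
      ((η : Measure (Joint Y U)).map fun z => (z, triMap TU z))) :
    IsConstantSpeedGeodesic p μ η ν (mccann η TU hTU) :=
  ⟨fun t _ => mccann_mem_condSpace hp hη hν hTU hT t, mccann_zero hTU, mccann_one hTU hT,
    fun _ _ hs hst ht => condWasserstein_mccann hp hη hν hTU hT hopt hs hst ht⟩

end Main

end CondOT

end

theorem mainTheorem6 {Y U : Type*}
    [NormedAddCommGroup Y] [InnerProductSpace ℝ Y] [CompleteSpace Y] [SecondCountableTopology Y]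
    [MeasurableSpace Y] [BorelSpace Y]
    [NormedAddCommGroup U] [InnerProductSpace ℝ U] [CompleteSpace U] [SecondCountableTopology U]
    [MeasurableSpace U] [BorelSpace U]
    (p : ℝ) (hp : 1 ≤ p) (μ : ProbabilityMeasure Y)
    (η ν : ProbabilityMeasure (CondOT.Joint Y U))
    (hη : η ∈ CondOT.condSpace p μ) (hν : ν ∈ CondOT.condSpace p μ)
    (TU : Y × U → U) (hTU : Measurable TU)
    (hinj : Function.Injective (CondOT.triMap TU))
    (hMonge : CondOT.IsCondMongeSolution p η ν TU)
    (hopt : CondOT.IsOptimalTriangularCoupling p η ν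
      ((η : Measure (CondOT.Joint Y U)).map (fun z => (z, CondOT.triMap TU z)))) :
    -- (a) the curve is absolutely continuous and a constant speed geodesic
    CondOT.IsACCurve p μ 0 1 (CondOT.mccann η TU hTU) ∧
    CondOT.IsConstantSpeedGeodesic p μ η ν (CondOT.mccann η TU hTU) ∧
    -- (b) for p > 1 there is a triangular Borel field with v_t(T_t(y,u)) = (0, T_U(y,u) - u)
    (1 < p → ∃ v : ℝ → CondOT.Joint Y U → CondOT.Joint Y U,
      CondOT.IsTriangularField v ∧
      (∀ᵐ z ∂(η : Measure (CondOT.Joint Y U)), ∀ t ∈ Icc (0 : ℝ) 1,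
        v t (CondOT.interp TU t z) = CondOT.displacement TU z) ∧
      CondOT.SolvesContinuityEquation 0 1
        (fun t => (CondOT.mccann η TU hTU t : Measure (CondOT.Joint Y U))) v) ∧
    -- for every p, any triangular Borel field with this property generates the curve
    (∀ v : ℝ → CondOT.Joint Y U → CondOT.Joint Y U,
      CondOT.IsTriangularField v →
      (∀ᵐ t ∂(volume.restrict (Ioo (0 : ℝ) 1)), ∀ᵐ z ∂(η : Measure (CondOT.Joint Y U)),
        v t (CondOT.interp TU t z) = CondOT.displacement TU z) →
      CondOT.SolvesContinuityEquation 0 1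
        (fun t => (CondOT.mccann η TU hTU t : Measure (CondOT.Joint Y U))) v) := by
  have hT := hMonge.1.2
  have hgeo := CondOT.isConstantSpeedGeodesic_mccann hp hη hν hTU hT hopt
  refine ⟨CondOT.isACCurve_of_isConstantSpeedGeodesic hgeo
    (CondOT.condWasserstein_ne_top hp hη hν hTU hT), hgeo, fun hp1 => ?_, fun v hv hvT =>
    CondOT.solvesContinuityEquation_mccann hp hη.1 hν.1 hTU hT hv hvT⟩
  obtain ⟨v, hv, hvT⟩ := CondOT.exists_velocity_field hp1 hη hν hTU hinj hT hopt
  refine ⟨v, hv, hvT, CondOT.solvesContinuityEquation_mccann hp hη.1 hν.1 hTU hT hv ?_⟩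
  filter_upwards [ae_restrict_mem measurableSet_Ioo] with t ht
  filter_upwards [hvT] with z hz using hz t ⟨ht.1.le, ht.2.le⟩
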